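/- Let $\mathcal{k}$ be $\mathbb{R}$ or $\mathbb{C}$ and let $r \le n$. Let $\operatorname{Herm}^+_{n,r}$ be the set of positive semidefinite $n\times n$ matrices over $\mathcal{k}$ of rank $r$, let $\operatorname{Herm}^{++}_r$ be the cone of positive definite $r\times r$ matrices, and let $\pi:\operatorname{Herm}^+_{n,r}\to \operatorname{Gr}(r,n)$, $\pi(A)=\ker(A)^\perp$. Let $d$ be the geodesic distance on $\operatorname{Gr}(r,n)$ for its canonical Riemannian metric (the metric $\operatorname{tr}(\Delta^*\Delta)$ on tangent vectors $\Delta\in\mathcal{k}^{n\times r}$, $Y^*\Delta=0$, at the span of an orthonormal frame $Y$), and let $\delta$ be the geodesic distance on $\operatorname{Herm}^{++}_r$ for the metric $\operatorname{Re}\operatorname{tr}(M^{-1}XM^{-1}Y)$. For $\mathbb{U},\mathbb{V}\in\operatorname{Gr}(r,n)$, principal vectors between $\mathbb{U}$ and $\mathbb{V}$ are orthonormal bases $(u_i)$ of $\mathbb{U}$ and $(v_j)$ of $\mathbb{V}$ such that $(u_i^*v_j)_{i,j}$ is diagonal with nonincreasing nonnegative diagonal entries. For $A,B\in\operatorname{Herm}^+_{n,r}$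 let $$\mathcal{Z}=\left\{\left((u_i^*Au_j)_{i,j},(v_i^*Bv_j)_{i,j}\right): (u,v)\text{ principal vectors between }\pi(A)\text{ and }\pi(B)\right\}\subseteq \operatorname{Herm}^{++}_r\times\operatorname{Herm}^{++}_r,$$ and let $\operatorname{GD}_{d,\delta}(A,B)=\left(d^2(\pi(A),\pi(B))+\delta_H^2(\mathcal{Z})\right)^{1/2}$, where $$\delta_H(\mathcal{Z})=\max\Big\{\sup_{x\in p_1(\mathcal{Z})}\ \inf_{y:(x,y)\in \mathcal{Z}}\delta(x,y),\ \sup_{y\in p_2(\mathcal{Z})}\ \inf_{x:(x,y)\in \mathcal{Z}}\delta(x,y)\Big\}$$ and $p_1,p_2$ are the two coordinate projections. For $A = Q\begin{bmatrix} M & 0\\ 0& 0\end{bmatrix}Q^*$ with $Q$ unitary (orthogonal if $\mathcal{k}=\mathbb{R}$) and $M\in\operatorname{Herm}^{++}_r$, let $H_A=\left\{Q\begin{bmatrix} 0 & X\\ X^*& 0\end{bmatrix}Q^*: X\in\mathcal{k}^{r\times(n-r)}\right\}$. A parallel transport of $A$ along a smooth curve $\gamma:[0,1]\to\operatorname{Gr}(r,n)$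 with $\gamma(0)=\pi(A)$ is a smooth curve $P^A_\gamma:[0,1]\to\operatorname{Herm}^+_{n,r}$ with $P^A_\gamma(0)=A$, $\pi(P^A_\gamma(t))=\gamma(t)$ and $\frac{d}{dt}P^A_\gamma(t)\in H_{P^A_\gamma(t)}$ for all $t \in [0,1]$. Then for all $A,B\in\operatorname{Herm}^+_{n,r}$: there is a length-minimizing geodesic $\gamma:[0,1]\to\operatorname{Gr}(r,n)$ from $\pi(A)$ to $\pi(B)$; along each such $\gamma$ the parallel transport $P^A_\gamma$ of $A$ exists and is unique; and $$\operatorname{GD}^2_{d,\delta}(A,B)=d^2(\pi(A),\pi(B))+\delta^2\left(\mathcal{A}_1,B|_{\pi(B)}\right),$$ where $$\mathcal{A}_1=\left\{P^A_\gamma(1)|_{\pi(B)}:\gamma\text{ is a length-minimizing geodesic from }\pi(A)\text{ to }\pi(B)\right\}$$ and $\delta(\mathcal{A}_1,B|_{\pi(B)})=\inf_{C\in\mathcal{A}_1}\delta(C,B|_{\pi(B)})$ is the point-set distance, computed after representing the operators on $\pi(B)$ as matrices in $\operatorname{Herm}^{++}_r$ with respect to any orthonormal basis of $\pi(B)$.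 -/

import Mathlib

open Set
open scoped Matrix ComplexOrder ContDiff Matrix.Norms.Frobenius

noncomputable section

namespace PSDBundle

/-! Throughout, `𝕜` is `ℝ` or `ℂ`, and the norm of a matrix is its Frobenius norm. -/

/-- The Grassmannian `Gr(r, n)`: the `r`-dimensional linear subspaces of `𝕜ⁿ`. -/
abbrev Gr (𝕜 : Type*) [RCLike 𝕜] (r n : ℕ) : Type _ :=
  {U : Submodule 𝕜 (EuclideanSpace 𝕜 (Fin n)) // Module.finrank 𝕜 U = r}

/-- The set `Herm⁺_{n,r}` of positive semidefinite `n × n` matrices of rank `r`. -/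
abbrev HermPSD (𝕜 : Type*) [RCLike 𝕜] (n r : ℕ) : Type _ :=
  {A : Matrix (Fin n) (Fin n) 𝕜 // A.PosSemidef ∧ A.rank = r}

/-- The cone `Herm_r⁺⁺` of positive definite `r × r` matrices. -/
abbrev HermPD (𝕜 : Type*) [RCLike 𝕜] (r : ℕ) : Type _ :=
  {M : Matrix (Fin r) (Fin r) 𝕜 // M.PosDef}

variable {𝕜 : Type*} [RCLike 𝕜] {n r s : ℕ}

theorem finrank_ker_orthogonal (A : Matrix (Fin n) (Fin n) 𝕜) :
    Module.finrank 𝕜 ((LinearMap.ker (Matrix.toEuclideanLin A))ᗮ : Submodule 𝕜 _) = A.rank := by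
  have h1 := (LinearMap.ker (Matrix.toEuclideanLin A)).finrank_add_finrank_orthogonal
  have h2 := LinearMap.finrank_range_add_finrank_ker (Matrix.toEuclideanLin A)
  have h3 : A.rank = Module.finrank 𝕜 (LinearMap.range (Matrix.toEuclideanLin A)) := by
    rw [Matrix.toEuclideanLin, Matrix.toLpLin_eq_toLin]
    exact Matrix.rank_eq_finrank_range_toLin A _ _
  omega

/-- The bundle projection `π_{n,r} : Herm⁺_{n,r} → Gr(r, n)`, `A ↦ ker(A)ᗮ`. -/
def proj (A : HermPSD 𝕜 n r) : Gr 𝕜 r n :=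
  ⟨(LinearMap.ker (Matrix.toEuclideanLin A.1))ᗮ, (finrank_ker_orthogonal A.1).trans A.2.2⟩

/-- The fibre of `π_{n,r}` over `U`, i.e. the positive operators on `U`
(extended by zero to `Uᗮ`). -/
abbrev Fiber (U : Gr 𝕜 r n) : Type _ := {A : HermPSD 𝕜 n r // proj A = U}

/-- The matrix `(wᵢ* A wⱼ)ᵢⱼ`. -/
def gramMatrix (A : Matrix (Fin n) (Fin n) 𝕜) (w : Fin r → EuclideanSpace 𝕜 (Fin n)) :
    Matrix (Fin r) (Fin r) 𝕜 :=
  Matrix.of fun i j => inner 𝕜 (w i) (Matrix.toEuclideanLin A (w j))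

theorem gramMatrix_posDef {U : Gr 𝕜 r n} (A : Fiber U) (w : OrthonormalBasis (Fin r) 𝕜 U.1) :
    (gramMatrix A.1.1 fun i => (w i : EuclideanSpace 𝕜 (Fin n))).PosDef := by
  obtain ⟨⟨A, hA, hr⟩, hU⟩ := A
  have hpos := Matrix.isPositive_toEuclideanLin_iff.2 hA
  have key : ∀ x y : Fin r → 𝕜,
      star x ⬝ᵥ ((gramMatrix A fun i => (w i : EuclideanSpace 𝕜 (Fin n))) *ᵥ y) =
        inner 𝕜 ((∑ i, x i • w i : U.1) : EuclideanSpace 𝕜 (Fin n))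
          (Matrix.toEuclideanLin A ((∑ i, y i • w i : U.1) : EuclideanSpace 𝕜 (Fin n))) := by
    intro x y
    simp only [gramMatrix, dotProduct, Matrix.mulVec, Matrix.of_apply, Pi.star_apply,
      Submodule.coe_sum, Submodule.coe_smul, map_sum, map_smul, sum_inner, inner_sum,
      inner_smul_left, inner_smul_right, RCLike.star_def]
    simp only [Finset.mul_sum]
    rw [Finset.sum_comm]
    refine Finset.sum_congr rfl fun j _ => Finset.sum_congr rfl fun i _ => ?_
    ring
  refine Matrix.posDef_iff_dotProduct_mulVec.2 ⟨?_, ?_⟩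
  · ext i j
    simp only [gramMatrix, Matrix.conjTranspose_apply, Matrix.of_apply, RCLike.star_def,
      inner_conj_symm]
    exact hpos.isSymmetric _ _
  · intro x hx
    rw [key]
    set v : U.1 := ∑ i, x i • w i with hv
    have hv0 : (v : EuclideanSpace 𝕜 (Fin n)) ≠ 0 := by
      intro h
      apply hx
      have h0 : v = 0 := Subtype.ext h
      have hli := w.orthonormal.linearIndependent
      rw [Fintype.linearIndependent_iff] at hli
      funext i
      exact hli x (hv.symm.trans h0) i
    have hnn : 0 ≤ inner 𝕜 (v : EuclideanSpace 𝕜 (Fin n)) (Matrix.toEuclideanLin A v) :=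
      hpos.inner_nonneg_right _
    refine lt_of_le_of_ne hnn fun h0 => hv0 ?_
    have hker : (v : EuclideanSpace 𝕜 (Fin n)) ∈ LinearMap.ker (Matrix.toEuclideanLin A) := by
      have h1 := (hA.dotProduct_mulVec_zero_iff (v : EuclideanSpace 𝕜 (Fin n)).ofLp).1 (by
        rw [h0, EuclideanSpace.inner_eq_star_dotProduct, dotProduct_comm]
        rfl)
      rw [LinearMap.mem_ker]
      ext i
      exact congrFun h1 i
    have hort : (v : EuclideanSpace 𝕜 (Fin n)) ∈ (LinearMap.ker (Matrix.toEuclideanLin A))ᗮ := by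
      have := congrArg Subtype.val hU
      have h2 : (LinearMap.ker (Matrix.toEuclideanLin A))ᗮ = U.1 := this
      rw [h2]
      exact v.2
    have := hort _ hker
    exact inner_self_eq_zero.1 this

/-- The matrix in `Herm_r⁺⁺` that represents the positive operator `A|_U` on `U` with respect to
an orthonormal basis `w` of `U`. -/
def matrixRep {U : Gr 𝕜 r n} (A : Fiber U) (w : OrthonormalBasis (Fin r) 𝕜 U.1) : HermPD 𝕜 r :=
  ⟨gramMatrix A.1.1 fun i => (w i : EuclideanSpace 𝕜 (Fin n)), gramMatrix_posDef A w⟩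

/-! ### The geometric distance -/

/-- `(u, v)` is a set of principal vectors between `U` and `V`: `u`, `v` are orthonormal bases of
`U`, `V` and `(uᵢ* vⱼ)ᵢⱼ` is a rectangular diagonal matrix with nonincreasing nonnegative diagonal
entries (the singular values, i.e. the cosines of the principal angles). -/
def IsPrincipal {U : Gr 𝕜 r n} {V : Gr 𝕜 s n} (u : OrthonormalBasis (Fin r) 𝕜 U.1)
    (v : OrthonormalBasis (Fin s) 𝕜 V.1) : Prop :=
  ∃ σ : ℕ → ℝ, Antitone σ ∧ (∀ i, 0 ≤ σ i) ∧
    ∀ (i : Fin r) (j : Fin s),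
      inner 𝕜 (u i : EuclideanSpace 𝕜 (Fin n)) (v j : EuclideanSpace 𝕜 (Fin n)) =
        if (i : ℕ) = (j : ℕ) then ((σ i : ℝ) : 𝕜) else 0

/-- The set `𝒵_{X,Y}` of pairs of matrices that represent `X` and `Y` with respect to all possible
principal vectors. -/
def repSet {U : Gr 𝕜 r n} {V : Gr 𝕜 s n} (X : Fiber U) (Y : Fiber V) :
    Set (HermPD 𝕜 r × HermPD 𝕜 s) :=
  {p | ∃ (u : OrthonormalBasis (Fin r) 𝕜 U.1) (v : OrthonormalBasis (Fin s) 𝕜 V.1),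
    IsPrincipal u v ∧ p = (matrixRep X u, matrixRep Y v)}

/-- The point-set distance `f(𝒳₁, y) = inf_{x ∈ 𝒳₁} f(x, y)`. -/
def setPointDist {α β : Type*} (f : α → β → ℝ) (S : Set α) (y : β) : ℝ :=
  sInf ((fun x => f x y) '' S)

/-- The point-set distance `f(x, 𝒴₁) = inf_{y ∈ 𝒴₁} f(x, y)`. -/
def pointSetDist {α β : Type*} (f : α → β → ℝ) (x : α) (S : Set β) : ℝ :=
  sInf ((fun y => f x y) '' S)

/-- The generalized Hausdorff distance `f_H(𝒵)` of a set `𝒵 ⊆ 𝒳 × 𝒴`. -/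
def hausdorffFn {α β : Type*} (f : α → β → ℝ) (Z : Set (α × β)) : ℝ :=
  max (sSup ((fun x => pointSetDist f x {y | (x, y) ∈ Z}) '' (Prod.fst '' Z)))
    (sSup ((fun y => setPointDist f {x | (x, y) ∈ Z} y) '' (Prod.snd '' Z)))

/-- The geometric distance `GD_{d,δ}(A, B)` for matrices `A`, `B` of the same size. -/
def GD (d : Gr 𝕜 r n → Gr 𝕜 s n → ℝ) (δ : HermPD 𝕜 r → HermPD 𝕜 s → ℝ)
    (A : HermPSD 𝕜 n r) (B : HermPSD 𝕜 n s) : ℝ :=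
  Real.sqrt (d (proj A) (proj B) ^ 2 +
    hausdorffFn δ (repSet (⟨A, rfl⟩ : Fiber (proj A)) (⟨B, rfl⟩ : Fiber (proj B))) ^ 2)

/-! ### The canonical geodesic distance on `Herm_r⁺⁺` -/

/-- The velocity at time `t` of a matrix-valued curve on `[0, 1]`. -/
def velocity (c : ℝ → Matrix (Fin n) (Fin n) 𝕜) (t : ℝ) : Matrix (Fin n) (Fin n) 𝕜 :=
  derivWithin c (Icc 0 1) t

/-- The length of a curve in `Herm_r⁺⁺` for the canonical (affine-invariant) Riemannian metric
`⟨X, Y⟩_M = Re tr(M⁻¹ X M⁻¹ Y)`. -/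
def pdLength (c : ℝ → HermPD 𝕜 r) : ℝ :=
  ∫ t in (0 : ℝ)..1, Real.sqrt (RCLike.re (Matrix.trace
    ((c t).1⁻¹ * velocity (fun τ => (c τ).1) t * (c t).1⁻¹ * velocity (fun τ => (c τ).1) t)))

/-- The geodesic distance on `Herm_r⁺⁺`: the infimum of the lengths of `C¹` curves from `C` to
`D`. -/
def pdDist (C D : HermPD 𝕜 r) : ℝ :=
  sInf {ℓ | ∃ c : ℝ → HermPD 𝕜 r, ContDiffOn ℝ 1 (fun t => (c t).1) (Icc 0 1) ∧
    c 0 = C ∧ c 1 = D ∧ ℓ = pdLength c}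

/-! ### The canonical Riemannian metric of the Grassmannian and its geodesics -/

/-- The orthogonal projection matrix onto `U`. Through it, `Gr(r, n)` is embedded as a submanifold
of the space of Hermitian matrices. -/
def projMatrix (U : Gr 𝕜 r n) : Matrix (Fin n) (Fin n) 𝕜 :=
  (Matrix.toEuclideanCLM (n := Fin n) (𝕜 := 𝕜)).symm U.1.starProjection

/-- A curve `[0, 1] → Gr(r, n)` of class `C^k`. -/
def IsGrCurve (k : WithTop ℕ∞) (γ : ℝ → Gr 𝕜 r n) : Prop :=
  ContDiffOn ℝ k (fun t => projMatrix (γ t)) (Icc 0 1)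

/-- The length of a curve in `Gr(r, n)` for the canonical Riemannian metric `tr(Δ* Δ)`, where
tangent vectors at the span of an orthonormal frame `Y` are written as `n × r` matrices `Δ` with
`Y* Δ = 0`. In terms of projection matrices `P = Y Y*` the tangent vector is
`P' = Δ Y* + Y Δ*`, so that `‖Δ‖ = ‖P'‖ / √2` in Frobenius norm. -/
def grLength (γ : ℝ → Gr 𝕜 r n) : ℝ :=
  ∫ t in (0 : ℝ)..1, ‖velocity (fun τ => projMatrix (γ τ)) t‖ / Real.sqrt 2

/-- The geodesic distance on `Gr(r, n)`: the infimum of the lengths of `C¹` curves from `U` to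
`V`. -/
def grDist (U V : Gr 𝕜 r n) : ℝ :=
  sInf {ℓ | ∃ γ : ℝ → Gr 𝕜 r n, IsGrCurve 1 γ ∧ γ 0 = U ∧ γ 1 = V ∧ ℓ = grLength γ}

/-- The tangent space of `Gr(r, n)` at `U`, in terms of projection matrices: the Hermitian matrices
`X` with `X P + P X = X`, where `P` is the projection matrix of `U`. -/
def grTangent (U : Gr 𝕜 r n) : Set (Matrix (Fin n) (Fin n) 𝕜) :=
  {X | X.IsHermitian ∧ X * projMatrix U + projMatrix U * X = X}

/-- Geodesics `[0, 1] → Gr(r, n)`: smooth curves whose acceleration in the ambient space is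
orthogonal to the tangent space of `Gr(r, n)` at every time. -/
def IsGeodesic (γ : ℝ → Gr 𝕜 r n) : Prop :=
  IsGrCurve ∞ γ ∧ ∀ t ∈ Icc (0 : ℝ) 1, ∀ X ∈ grTangent (γ t),
    RCLike.re (Matrix.trace
      (Xᴴ * iteratedDerivWithin 2 (fun τ => projMatrix (γ τ)) (Icc 0 1) t)) = 0

/-- `γ` is a (length-minimizing) geodesic that connects `U` and `V`. -/
def IsMinGeodesic (U V : Gr 𝕜 r n) (γ : ℝ → Gr 𝕜 r n) : Prop :=
  IsGeodesic γ ∧ γ 0 = U ∧ γ 1 = V ∧ grLength γ = grDist U V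

/-! ### Parallel transport -/

/-- The matrix `Q [[M, X], [Y, N]] Q*`. -/
def conjBlock (Q : Matrix (Fin n) (Fin r ⊕ Fin (n - r)) 𝕜)
    (M : Matrix (Fin r) (Fin r) 𝕜) (X : Matrix (Fin r) (Fin (n - r)) 𝕜)
    (Y : Matrix (Fin (n - r)) (Fin r) 𝕜) (N : Matrix (Fin (n - r)) (Fin (n - r)) 𝕜) :
    Matrix (Fin n) (Fin n) 𝕜 :=
  let QB : Matrix (Fin n) (Fin r ⊕ Fin (n - r)) 𝕜 := Q * Matrix.fromBlocks M X Y N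
  QB * Qᴴ

/-- The horizontal space `H_A` at `A = Q [[M, 0], [0, 0]] Q*`: it consists of the matrices
`Q [[0, X], [X*, 0]] Q*`, where `X` is an arbitrary `r × (n - r)` matrix. It does not depend on the
choice of `Q` unitary and `M`. -/
def horizontalSpace (A : HermPSD 𝕜 n r) : Set (Matrix (Fin n) (Fin n) 𝕜) :=
  {Y | ∃ (Q : Matrix (Fin n) (Fin r ⊕ Fin (n - r)) 𝕜) (M : Matrix (Fin r) (Fin r) 𝕜)
    (X : Matrix (Fin r) (Fin (n - r)) 𝕜),
    Qᴴ * Q = 1 ∧ Q * Qᴴ = 1 ∧ A.1 = conjBlock Q M 0 0 0 ∧ Y = conjBlock Q 0 X Xᴴ 0}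

/-- `P : [0, 1] → Herm⁺_{n,r}` is the parallel transport of `A` along `γ` for the Ehresmann
connection `A ↦ H_A`. -/
def IsParallelTransport (A : HermPSD 𝕜 n r) (γ : ℝ → Gr 𝕜 r n) (P : ℝ → HermPSD 𝕜 n r) : Prop :=
  ContDiffOn ℝ ∞ (fun t => (P t).1) (Icc 0 1) ∧ P 0 = A ∧
    ∀ t ∈ Icc (0 : ℝ) 1, proj (P t) = γ t ∧
      velocity (fun τ => (P τ).1) t ∈ horizontalSpace (P t)

/-- The set `𝒜₁` of the end points `P_γ^A(1)`, as positive operators on `π(B)`, of the parallel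
transports of `A` along the geodesics `γ` that connect `π(A)` and `π(B)`. -/
def transportSet (A B : HermPSD 𝕜 n r) : Set (Fiber (proj B)) :=
  {C | ∃ (γ : ℝ → Gr 𝕜 r n) (P : ℝ → HermPSD 𝕜 n r),
    IsMinGeodesic (proj A) (proj B) γ ∧ IsParallelTransport A γ P ∧ P 1 = C.1}

end PSDBundle

end

set_option linter.unusedSectionVars false

namespace PSDBundle

/-! ### Calculus of matrix-valued curves -/

section MatrixCalculus

variable {𝕜 : Type*} [RCLike 𝕜] {l m n : Type*} [Fintype l] [Fintype m] [Fintype n]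

/-! The Grassmannian is handled through projection matrices. A geodesic through `U` with projection
`p` is an orbit `exp(tΩ) p exp(-tΩ)`, where `Ω` is skew-Hermitian and off-diagonal with respect to
`p` (`Ωp + pΩ = Ω`): normal acceleration means that `P''` commutes with `P`, so `[P', P]` is
constant and serves as `Ω` (`IsGeodesic.exists_isOrbit`). Parallel transport along such an orbit is
conjugation by the same `exp(tΩ)`, because horizontality together with the prescribed base curve
forces the linear equation `P' = ΩP - PΩ` (`IsParallelTransport.eq_conj_exp`).

Minimizing geodesics correspond to principal vectors. Given principal frames `F`, `H` with cosines
`σ`, the rotation through the angles `arccos σ` carries `F` to `H` with length `√(∑ arccos(σ i)²)`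
(`IsFramePair.exists_generator`), and no curve is shorter (`sqrt_sum_arccos_sq_le_grLength`).
Conversely, minimality forces all rotation angles of a geodesic to be at most `π/2`, so `exp Ω` maps
a principal frame to its partner (`IsMinGeodesic.exists_isFramePair`). Since transport and frame
move under the same unitary, the transported matrix read in `v` is the matrix of `A` read in `u`
(`IsParallelTransport.matrixRep_eq`). Thus the distances from transports to `B` are exactly the
distances `δ(x, y)` with `(x, y) ∈ 𝒵` (`image_transportSet`).

It remains to see that the Hausdorff-type quantity is the plain infimum over `𝒵`. Two pairs of
principal vectors may be made to share their first member by rotating both members of one pair by a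
common unitary (`IsPrincipal.exists_rotate`), and `δ` is invariant under simultaneous unitary
conjugation (`pdDist_conjPD`). Every slice of `𝒵`, in either coordinate, therefore yields the same
set of distances, and both suprema are trivial (`hausdorffFn_repSet`). -/

theorem hasDerivWithinAt_matrix {f : ℝ → Matrix m n 𝕜} {f' : Matrix m n 𝕜} {s : Set ℝ} {t : ℝ} :
    HasDerivWithinAt f f' s t ↔ ∀ i j, HasDerivWithinAt (fun t => f t i j) (f' i j) s t :=
  Iff.trans (hasDerivWithinAt_pi (E' := fun _ : m => n → 𝕜)) (forall_congr' fun _ => hasDerivWithinAt_pi)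

theorem _root_.HasDerivWithinAt.matrix_mul {f : ℝ → Matrix l m 𝕜} {g : ℝ → Matrix m n 𝕜}
    {f' : Matrix l m 𝕜} {g' : Matrix m n 𝕜} {s : Set ℝ} {t : ℝ}
    (hf : HasDerivWithinAt f f' s t) (hg : HasDerivWithinAt g g' s t) :
    HasDerivWithinAt (fun t => f t * g t) (f' * g t + f t * g') s t := by
  rw [hasDerivWithinAt_matrix] at *
  intro i j
  simp only [Matrix.mul_apply, Matrix.add_apply, ← Finset.sum_add_distrib]
  exact HasDerivWithinAt.fun_sum fun k _ => (hf i k).mul (hg k j)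

theorem _root_.HasDerivWithinAt.matrix_const_mul {g : ℝ → Matrix m n 𝕜} {g' : Matrix m n 𝕜}
    {s : Set ℝ} {t : ℝ} (F : Matrix l m 𝕜) (hg : HasDerivWithinAt g g' s t) :
    HasDerivWithinAt (fun t => F * g t) (F * g') s t := by
  simpa using (hasDerivWithinAt_const t s F).matrix_mul hg

theorem _root_.HasDerivWithinAt.matrix_mul_const {f : ℝ → Matrix l m 𝕜} {f' : Matrix l m 𝕜}
    {s : Set ℝ} {t : ℝ} (hf : HasDerivWithinAt f f' s t) (F : Matrix m n 𝕜) :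
    HasDerivWithinAt (fun t => f t * F) (f' * F) s t := by
  simpa using hf.matrix_mul (hasDerivWithinAt_const t s F)

theorem _root_.HasDerivWithinAt.matrix_conjTranspose {f : ℝ → Matrix l m 𝕜} {f' : Matrix l m 𝕜}
    {s : Set ℝ} {t : ℝ} (hf : HasDerivWithinAt f f' s t) :
    HasDerivWithinAt (fun t => (f t)ᴴ) f'ᴴ s t := by
  rw [hasDerivWithinAt_matrix] at *
  exact fun i j => (hf j i).star

theorem contDiffOn_matrix {f : ℝ → Matrix m n 𝕜} {s : Set ℝ} {k : WithTop ℕ∞} :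
    ContDiffOn ℝ k f s ↔ ∀ i j, ContDiffOn ℝ k (fun t => f t i j) s := by
  let e : Matrix m n 𝕜 ≃L[ℝ] (m → n → 𝕜) := ContinuousLinearEquiv.refl ℝ _
  rw [← e.comp_contDiffOn_iff, contDiffOn_pi]
  exact forall_congr' fun i => contDiffOn_pi

theorem _root_.ContDiffOn.matrix_mul {f : ℝ → Matrix l m 𝕜} {g : ℝ → Matrix m n 𝕜}
    {s : Set ℝ} {k : WithTop ℕ∞} (hf : ContDiffOn ℝ k f s) (hg : ContDiffOn ℝ k g s) :
    ContDiffOn ℝ k (fun t => f t * g t) s := by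
  rw [contDiffOn_matrix] at *
  intro i j
  simp only [Matrix.mul_apply]
  exact ContDiffOn.sum fun k _ => (hf i k).mul (hg k j)

theorem norm_sq_eq_re_trace (X : Matrix m n 𝕜) : ‖X‖ ^ 2 = RCLike.re (Xᴴ * X).trace := by
  rw [Matrix.frobenius_norm_def, ← Real.sqrt_eq_rpow, Real.sq_sqrt (by positivity)]
  simp [Matrix.trace, Matrix.mul_apply, RCLike.conj_mul]
  rw [Finset.sum_comm]

theorem norm_isometry_mul [DecidableEq m] (G : Matrix l m 𝕜) (hG : Gᴴ * G = 1)
    (X : Matrix m n 𝕜) : ‖G * X‖ = ‖X‖ := by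
  rw [← sq_eq_sq₀ (norm_nonneg _) (norm_nonneg _), norm_sq_eq_re_trace, norm_sq_eq_re_trace,
    Matrix.conjTranspose_mul, Matrix.mul_assoc, ← Matrix.mul_assoc Gᴴ, hG, Matrix.one_mul]

theorem eq_of_hasDerivWithinAt_zero {f : ℝ → Matrix m n 𝕜}
    (hf : ∀ t ∈ Icc (0 : ℝ) 1, HasDerivWithinAt f 0 (Icc 0 1) t) : ∀ t ∈ Icc (0 : ℝ) 1, f t = f 0 :=
  constant_of_derivWithin_zero (fun t ht => (hf t ht).differentiableWithinAt) fun t ht =>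
    (hf t (Ico_subset_Icc_self ht)).derivWithin
      (uniqueDiffOn_Icc zero_lt_one _ (Ico_subset_Icc_self ht))

variable [DecidableEq n]

/-- Linear differential equations with skew-Hermitian coefficients have unitary solutions. -/
theorem exists_unitary_flow (Ω : ℝ → Matrix n n 𝕜) (hc : ContinuousOn Ω (Icc 0 1))
    (hskew : ∀ t ∈ Icc (0 : ℝ) 1, (Ω t)ᴴ = -Ω t) :
    ∃ G : ℝ → Matrix n n 𝕜, G 0 = 1 ∧ ∀ t ∈ Icc (0 : ℝ) 1, (G t)ᴴ * G t = 1 ∧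
      HasDerivWithinAt G (Ω t * G t) (Icc 0 1) t := by
  obtain ⟨M, hM⟩ := isCompact_Icc.exists_bound_of_continuousOn hc
  have hM0 : 0 ≤ M := (norm_nonneg _).trans (hM 0 (by simp))
  lift M to NNReal using hM0
  have hM0 : 0 ≤ (M : ℝ) := M.2
  let N : ℝ := Fintype.card n
  have hN : 0 ≤ N := by positivity
  -- A real radial factor makes the vector field bounded, so that Picard-Lindelöf reaches all of
  -- `[0, 1]`: the speed is at most `M (1 + N)`, which is also the radius `a` of the ball. The
  -- factor equals 1 when `‖X‖² = N`, as for unitary matrices.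
  let ψ : Matrix n n 𝕜 → ℝ := fun X => (1 + N) / (1 + ‖X‖ ^ 2)
  have hψ0 : ∀ X, 0 < ψ X := fun X => by positivity
  have hns : ContDiff ℝ 1 fun X : Matrix n n 𝕜 => ‖X‖ ^ 2 := by
    have : (fun X : Matrix n n 𝕜 => ‖X‖ ^ 2) = fun X => ∑ i, ∑ j, ‖X i j‖ ^ 2 := by
      funext X
      rw [Matrix.frobenius_norm_def, ← Real.sqrt_eq_rpow, Real.sq_sqrt (by positivity)]
      norm_cast
    rw [this]
    refine ContDiff.sum fun i _ => ContDiff.sum fun j _ => ?_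
    have hl : ContDiff ℝ 1 fun X : Matrix n n 𝕜 => X i j :=
      (LinearMap.toContinuousLinearMap (Matrix.entryLinearMap ℝ 𝕜 i j)).contDiff
    exact (contDiff_norm_sq 𝕜).comp hl
  have hφ : ContDiff ℝ 1 fun X : Matrix n n 𝕜 => ψ X • X :=
    (contDiff_const.div (contDiff_const.add hns) fun X => by positivity).smul contDiff_id
  have hφb : ∀ X : Matrix n n 𝕜, ‖ψ X • X‖ ≤ 1 + N := by
    intro X
    rw [norm_smul, Real.norm_of_nonneg (hψ0 X).le, div_mul_eq_mul_div, div_le_iff₀ (by positivity)]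
    have := norm_nonneg X
    nlinarith [sq_nonneg (‖X‖ - 1)]
  let a : NNReal := M * (1 + Fintype.card n)
  obtain ⟨K, hK⟩ := (hφ.contDiffOn (s := Metric.closedBall (1 : Matrix n n 𝕜) a)).exists_lipschitzOnWith
    one_ne_zero (convex_closedBall _ _) (isCompact_closedBall _ _)
  have hPL : IsPicardLindelof (fun t X => Ω t * (ψ X • X)) (tmin := 0) (tmax := 1)
      ⟨0, by simp⟩ 1 a 0 a (M * K) := by
    refine ⟨fun t ht => ?_, fun X _ => hc.mul continuousOn_const, fun t ht X _ => ?_, ?_⟩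
    · refine LipschitzOnWith.of_dist_le_mul fun X hX Y hY => ?_
      rw [dist_eq_norm, ← mul_sub]
      refine (norm_mul_le _ _).trans ?_
      rw [← dist_eq_norm, NNReal.coe_mul, mul_assoc]
      exact mul_le_mul (hM t ht) (hK.dist_le_mul X hX Y hY) dist_nonneg hM0
    · refine (norm_mul_le _ _).trans ((mul_le_mul (hM t ht) (hφb X) (norm_nonneg _) hM0).trans ?_)
      simp [a, N]
    · simp
  obtain ⟨G, hG0, hG⟩ := hPL.exists_eq_forall_mem_Icc_hasDerivWithinAt₀
  simp only at hG0
  -- The real scalar `ψ` does not disturb skewness, so `G* G` is conserved by the modified equation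
  -- too.
  have hU : ∀ t ∈ Icc (0 : ℝ) 1, (G t)ᴴ * G t = 1 := by
    intro t ht
    have := eq_of_hasDerivWithinAt_zero (f := fun t => (G t)ᴴ * G t) (fun t ht => by
      convert (hG t ht).matrix_conjTranspose.matrix_mul (hG t ht) using 1
      simp [Matrix.conjTranspose_smul, hskew t ht, Matrix.mul_assoc]) t ht
    simpa [hG0] using this
  refine ⟨G, hG0, fun t ht => ⟨hU t ht, ?_⟩⟩
  have h1 : ψ (G t) = 1 := by
    simp only [ψ]
    rw [norm_sq_eq_re_trace, hU t ht]
    simp only [Matrix.trace_one, RCLike.natCast_re]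
    exact div_self (by positivity)
  have h2 := hG t ht
  rw [h1, one_smul] at h2
  exact h2

/-! ### One-parameter groups of unitary matrices -/

theorem hasDerivAt_exp_smul (Ω : Matrix n n 𝕜) (t : ℝ) :
    HasDerivAt (fun t : ℝ => NormedSpace.exp (t • Ω)) (Ω * NormedSpace.exp (t • Ω)) t :=
  hasDerivAt_exp_smul_const' Ω t

theorem hasDerivAt_exp_neg_smul (Ω : Matrix n n 𝕜) (t : ℝ) :
    HasDerivAt (fun t : ℝ => NormedSpace.exp (t • (-Ω))) (-(NormedSpace.exp (t • (-Ω)) * Ω)) t := by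
  rw [← Matrix.mul_neg]
  exact hasDerivAt_exp_smul_const (-Ω) t

theorem exp_neg_smul_mul (Ω : Matrix n n 𝕜) (t : ℝ) :
    NormedSpace.exp (t • (-Ω)) * NormedSpace.exp (t • Ω) = 1 := by
  rw [← Matrix.exp_add_of_commute]
  · simp
  · rw [smul_neg]; exact (Commute.refl _).neg_left

theorem exp_mul_neg_smul (Ω : Matrix n n 𝕜) (t : ℝ) :
    NormedSpace.exp (t • Ω) * NormedSpace.exp (t • (-Ω)) = 1 := by
  simpa using exp_neg_smul_mul (-Ω) t

theorem conjTranspose_exp_smul {Ω : Matrix n n 𝕜} (h : Ωᴴ = -Ω) (t : ℝ) :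
    (NormedSpace.exp (t • Ω))ᴴ = NormedSpace.exp (t • (-Ω)) := by
  rw [← Matrix.exp_conjTranspose, Matrix.conjTranspose_smul, h]
  simp

theorem contDiff_exp_smul (Ω : Matrix n n 𝕜) {k : WithTop ℕ∞} :
    ContDiff ℝ k fun t : ℝ => NormedSpace.exp (t • Ω) := by
  have h : AnalyticOnNhd ℝ (NormedSpace.exp : Matrix n n 𝕜 → _) univ :=
    fun x _ => NormedSpace.exp_analytic x
  exact h.contDiff.comp (contDiff_id.smul contDiff_const)

/-- Solutions of `X' = Ω X` are given by the exponential. -/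
theorem eq_exp_smul_mul {Ω : Matrix n n 𝕜} {X : ℝ → Matrix n m 𝕜}
    (hX : ∀ t ∈ Icc (0 : ℝ) 1, HasDerivWithinAt X (Ω * X t) (Icc 0 1) t) :
    ∀ t ∈ Icc (0 : ℝ) 1, X t = NormedSpace.exp (t • Ω) * X 0 := by
  intro t ht
  have := eq_of_hasDerivWithinAt_zero (f := fun t => NormedSpace.exp (t • (-Ω)) * X t)
    (fun t ht => by
      convert (hasDerivAt_exp_neg_smul Ω t).hasDerivWithinAt.matrix_mul (hX t ht) using 1
      simp [Matrix.mul_assoc]) t ht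
  simp only [zero_smul, NormedSpace.exp_zero, Matrix.one_mul] at this
  rw [← this, ← Matrix.mul_assoc, exp_mul_neg_smul, Matrix.one_mul]

/-- Solutions of `X' = Ω X - X Ω` are given by conjugation with the exponential. -/
theorem eq_exp_smul_mul_mul {Ω : Matrix n n 𝕜} {X : ℝ → Matrix n n 𝕜}
    (hX : ∀ t ∈ Icc (0 : ℝ) 1, HasDerivWithinAt X (Ω * X t - X t * Ω) (Icc 0 1) t) :
    ∀ t ∈ Icc (0 : ℝ) 1, X t = NormedSpace.exp (t • Ω) * X 0 * NormedSpace.exp (t • (-Ω)) := by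
  intro t ht
  have := eq_exp_smul_mul (Ω := Ω) (X := fun t => X t * NormedSpace.exp (t • Ω)) (fun t ht => by
    convert (hX t ht).matrix_mul (hasDerivAt_exp_smul Ω t).hasDerivWithinAt using 1
    simp [Matrix.mul_assoc, Matrix.sub_mul]) t ht
  simp only [zero_smul, NormedSpace.exp_zero, Matrix.mul_one] at this
  rw [← this, Matrix.mul_assoc, exp_mul_neg_smul, Matrix.mul_one]

theorem hasDerivAt_conj_exp (Ω X : Matrix n n 𝕜) (t : ℝ) :
    HasDerivAt (fun t : ℝ => NormedSpace.exp (t • Ω) * X * NormedSpace.exp (t • (-Ω)))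
      (Ω * (NormedSpace.exp (t • Ω) * X * NormedSpace.exp (t • (-Ω))) -
        NormedSpace.exp (t • Ω) * X * NormedSpace.exp (t • (-Ω)) * Ω) t := by
  refine hasDerivWithinAt_univ.1 ((((hasDerivAt_exp_smul Ω t).hasDerivWithinAt.matrix_mul_const
    X).matrix_mul (hasDerivAt_exp_neg_smul Ω t).hasDerivWithinAt).congr_deriv ?_)
  simp [Matrix.mul_assoc, sub_eq_add_neg]

/-- `Ω` rotates each pair of columns of `F`, `W` at speed `θ i`, so `F cos(tθ) + W sin(tθ)` solves
`X' = ΩX` with `X(0) = F`. Orthonormality is not needed, hence columns of `W` may vanish. -/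
theorem exp_smul_mul_frame [DecidableEq m] {Ω : Matrix n n 𝕜} {F W : Matrix n m 𝕜} {θ : m → ℝ}
    (hF : Ω * F = W * Matrix.diagonal fun i => (θ i : 𝕜))
    (hW : Ω * W = -(F * Matrix.diagonal fun i => (θ i : 𝕜))) :
    NormedSpace.exp Ω * F = F * (Matrix.diagonal fun i => ((Real.cos (θ i) : ℝ) : 𝕜)) +
      W * Matrix.diagonal fun i => ((Real.sin (θ i) : ℝ) : 𝕜) := by
  have hd : ∀ (f f' : m → ℝ → ℝ) (t : ℝ), (∀ i, HasDerivAt (f i) (f' i t) t) →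
      HasDerivWithinAt (fun t => Matrix.diagonal fun i => ((f i t : ℝ) : 𝕜))
        (Matrix.diagonal fun i => ((f' i t : ℝ) : 𝕜)) (Icc 0 1) t := by
    intro f f' t h
    rw [hasDerivWithinAt_matrix]
    intro i j
    by_cases hij : i = j
    · subst hij
      have := ((RCLike.ofRealCLM (K := 𝕜)).hasFDerivAt.comp_hasDerivAt t (h i)).hasDerivWithinAt
        (s := Icc (0 : ℝ) 1)
      simp only [Matrix.diagonal_apply_eq]
      exact this
    · simpa [hij] using hasDerivWithinAt_const t _ (0 : 𝕜)
  have := eq_exp_smul_mul (Ω := Ω) (X := fun t =>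
      F * (Matrix.diagonal fun i => ((Real.cos (t * θ i) : ℝ) : 𝕜)) +
      W * Matrix.diagonal fun i => ((Real.sin (t * θ i) : ℝ) : 𝕜)) (fun t ht => by
    have h1 := hd (fun i t => Real.cos (t * θ i)) (fun i t => -Real.sin (t * θ i) * θ i) t fun i => by
      simpa using ((hasDerivAt_id t).mul_const (θ i)).cos
    have h2 := hd (fun i t => Real.sin (t * θ i)) (fun i t => Real.cos (t * θ i) * θ i) t fun i => by
      simpa using ((hasDerivAt_id t).mul_const (θ i)).sin
    refine ((h1.matrix_const_mul F).add (h2.matrix_const_mul W)).congr_deriv (Eq.symm ?_)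
    rw [Matrix.mul_add, ← Matrix.mul_assoc, ← Matrix.mul_assoc, hF, hW, Matrix.mul_assoc,
      Matrix.neg_mul, Matrix.mul_assoc, Matrix.diagonal_mul_diagonal, Matrix.diagonal_mul_diagonal,
      add_comm, ← Matrix.mul_neg, Matrix.diagonal_neg]
    congr 3 <;> ext i <;> simp [mul_comm]) 1 (by simp)
  simpa using this.symm

end MatrixCalculus

/-! ### Orthonormal frames -/

section Frames

variable {𝕜 : Type*} [RCLike 𝕜] {n r s : ℕ}

/-- The `n × r` matrix whose columns are the vectors `u i`. -/
def frame (u : Fin r → EuclideanSpace 𝕜 (Fin n)) : Matrix (Fin n) (Fin r) 𝕜 :=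
  Matrix.of fun k i => u i k

/-- The frame of an orthonormal basis of a subspace. -/
noncomputable abbrev basisFrame {U : Submodule 𝕜 (EuclideanSpace 𝕜 (Fin n))}
    (u : OrthonormalBasis (Fin r) 𝕜 U) : Matrix (Fin n) (Fin r) 𝕜 :=
  frame fun i => (u i : EuclideanSpace 𝕜 (Fin n))

theorem frame_apply (u : Fin r → EuclideanSpace 𝕜 (Fin n)) (k : Fin n) (i : Fin r) :
    frame u k i = u i k := rfl

theorem inner_eq_frame (u : Fin r → EuclideanSpace 𝕜 (Fin n)) (v : Fin s → EuclideanSpace 𝕜 (Fin n))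
    (i : Fin r) (j : Fin s) : inner 𝕜 (u i) (v j) = ((frame u)ᴴ * frame v) i j := by
  simp [Matrix.mul_apply, frame_apply, PiLp.inner_apply, mul_comm]

theorem gramMatrix_eq (A : Matrix (Fin n) (Fin n) 𝕜) (w : Fin r → EuclideanSpace 𝕜 (Fin n)) :
    gramMatrix A w = (frame w)ᴴ * A * frame w := by
  have h : frame (fun j => Matrix.toEuclideanLin A (w j)) = A * frame w := by
    ext k j
    simp [frame_apply, Matrix.toLpLin_apply, Matrix.mulVec, dotProduct, Matrix.mul_apply]
  ext i j
  rw [Matrix.mul_assoc, ← h, ← inner_eq_frame]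
  rfl

theorem orthonormal_iff_frame (u : Fin r → EuclideanSpace 𝕜 (Fin n)) :
    Orthonormal 𝕜 u ↔ (frame u)ᴴ * frame u = 1 := by
  rw [orthonormal_iff_ite, ← Matrix.ext_iff]
  simp [inner_eq_frame, Matrix.one_apply]

theorem basisFrame_conjTranspose_mul {U : Submodule 𝕜 (EuclideanSpace 𝕜 (Fin n))}
    (u : OrthonormalBasis (Fin r) 𝕜 U) : (basisFrame u)ᴴ * basisFrame u = 1 := by
  rw [← orthonormal_iff_frame]
  exact u.orthonormal.comp_linearIsometry U.subtypeₗᵢ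

theorem toEuclideanCLM_projMatrix (U : Gr 𝕜 r n) :
    Matrix.toEuclideanCLM (n := Fin n) (𝕜 := 𝕜) (projMatrix U) = U.1.starProjection :=
  StarAlgEquiv.apply_symm_apply _ _

theorem basisFrame_mul_conjTranspose {U : Gr 𝕜 r n} (u : OrthonormalBasis (Fin r) 𝕜 U.1) :
    basisFrame u * (basisFrame u)ᴴ = projMatrix U := by
  apply EquivLike.injective (Matrix.toEuclideanCLM (n := Fin n) (𝕜 := 𝕜))
  rw [toEuclideanCLM_projMatrix, u.starProjection_eq_sum_rankOne]
  ext x k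
  rw [Matrix.ofLp_toEuclideanCLM]
  simp only [Matrix.mulVec, dotProduct, Matrix.mul_apply, frame_apply,
    Matrix.conjTranspose_apply, sum_apply, InnerProductSpace.rankOne_apply,
    PiLp.inner_apply, Finset.sum_mul, WithLp.ofLp_sum, Finset.sum_apply, WithLp.ofLp_smul,
    Pi.smul_apply, smul_eq_mul, RCLike.inner_apply, RCLike.star_def]
  rw [Finset.sum_comm]
  exact Finset.sum_congr rfl fun i _ => Finset.sum_congr rfl fun j _ => by ring

theorem exists_basis (U : Gr 𝕜 r n) : Nonempty (OrthonormalBasis (Fin r) 𝕜 U.1) :=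
  ⟨(stdOrthonormalBasis 𝕜 U.1).reindex (finCongr U.2)⟩

theorem exists_frame (U : Gr 𝕜 r n) :
    ∃ F : Matrix (Fin n) (Fin r) 𝕜, Fᴴ * F = 1 ∧ F * Fᴴ = projMatrix U := by
  obtain ⟨u⟩ := exists_basis U
  exact ⟨basisFrame u, basisFrame_conjTranspose_mul u, basisFrame_mul_conjTranspose u⟩

theorem projMatrix_isHermitian (U : Gr 𝕜 r n) : (projMatrix U)ᴴ = projMatrix U := by
  obtain ⟨F, -, hF⟩ := exists_frame U
  simp [← hF]

theorem projMatrix_mul_self (U : Gr 𝕜 r n) : projMatrix U * projMatrix U = projMatrix U := by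
  obtain ⟨F, h1, hF⟩ := exists_frame U
  rw [← hF, Matrix.mul_assoc, ← Matrix.mul_assoc Fᴴ, h1, Matrix.one_mul]

theorem trace_projMatrix (U : Gr 𝕜 r n) : (projMatrix U).trace = r := by
  obtain ⟨F, h1, hF⟩ := exists_frame U
  rw [← hF, Matrix.trace_mul_comm, h1]
  simp

theorem projMatrix_injective : Function.Injective (projMatrix : Gr 𝕜 r n → _) := by
  intro U V h
  have := (Matrix.toEuclideanCLM (n := Fin n) (𝕜 := 𝕜)).symm.injective h
  exact Subtype.ext (Submodule.starProjection_inj.1 this)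

theorem exists_basis_of_frame (F : Matrix (Fin n) (Fin r) 𝕜) (hF : Fᴴ * F = 1) :
    ∃ (U : Gr 𝕜 r n) (u : OrthonormalBasis (Fin r) 𝕜 U.1), basisFrame u = F := by
  let f : Fin r → EuclideanSpace 𝕜 (Fin n) := fun i => WithLp.toLp 2 fun k => F k i
  have hf : frame f = F := rfl
  have ho : Orthonormal 𝕜 f := (orthonormal_iff_frame f).2 hF
  have hmem : ∀ i, f i ∈ Submodule.span 𝕜 (range f) := fun i => Submodule.subset_span ⟨i, rfl⟩
  have hr : Module.finrank 𝕜 (Submodule.span 𝕜 (range f)) = r := by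
    simpa using finrank_span_eq_card ho.linearIndependent
  let g : Fin r → Submodule.span 𝕜 (range f) := fun i => ⟨f i, hmem i⟩
  have hg : Orthonormal 𝕜 g := by
    rw [orthonormal_iff_ite] at ho ⊢
    exact ho
  refine ⟨⟨_, hr⟩, OrthonormalBasis.mk hg ?_, ?_⟩
  · exact (hg.linearIndependent.span_eq_top_of_card_eq_finrank' (by simp [hr])).ge
  · rw [← hf]
    refine congrArg frame (funext fun i => ?_)
    rw [OrthonormalBasis.coe_mk]

theorem exists_projMatrix_eq (F : Matrix (Fin n) (Fin r) 𝕜) (hF : Fᴴ * F = 1) :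
    ∃ U : Gr 𝕜 r n, projMatrix U = F * Fᴴ := by
  obtain ⟨U, u, rfl⟩ := exists_basis_of_frame F hF
  exact ⟨U, (basisFrame_mul_conjTranspose u).symm⟩

theorem exists_basis_frame_eq {U : Gr 𝕜 r n} (F : Matrix (Fin n) (Fin r) 𝕜) (hF : Fᴴ * F = 1)
    (hU : F * Fᴴ = projMatrix U) : ∃ u : OrthonormalBasis (Fin r) 𝕜 U.1, basisFrame u = F := by
  obtain ⟨V, u, hu⟩ := exists_basis_of_frame F hF
  obtain rfl : V = U := projMatrix_injective (by rw [← hU, ← hu, basisFrame_mul_conjTranspose])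
  exact ⟨u, hu⟩

/-- For a Hermitian idempotent, `tr p = tr(p* p)`, the squared Frobenius norm. -/
theorem eq_zero_of_isIdempotent {p : Matrix (Fin n) (Fin n) 𝕜} (hp : pᴴ = p) (hp2 : p * p = p)
    (ht : p.trace = 0) : p = 0 := by
  rw [← Matrix.trace_conjTranspose_mul_self_eq_zero_iff, hp, hp2, ht]

/-! ### The projection of a positive semidefinite matrix -/

theorem projMatrix_proj_mul_eq_zero (A : HermPSD 𝕜 n r) {N : Matrix (Fin n) (Fin s) 𝕜}
    (h : A.1 * N = 0) : projMatrix (proj A) * N = 0 := by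
  ext k j
  let x : EuclideanSpace 𝕜 (Fin n) := WithLp.toLp 2 fun k => N k j
  have hx : x ∈ LinearMap.ker (Matrix.toEuclideanLin A.1) := by
    rw [LinearMap.mem_ker]
    ext k
    exact congrFun (congrFun h k) j
  have h1 : (proj A).1.starProjection x = 0 := by
    rw [Submodule.starProjection_apply_eq_zero_iff]
    exact Submodule.le_orthogonal_orthogonal _ hx
  have h2 : Matrix.toEuclideanCLM (n := Fin n) (𝕜 := 𝕜) (projMatrix (proj A)) x = 0 := by
    rwa [toEuclideanCLM_projMatrix]
  have h3 := congrArg (fun y : EuclideanSpace 𝕜 (Fin n) => y.ofLp k) h2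
  simp only [Matrix.ofLp_toEuclideanCLM] at h3
  exact h3

theorem mul_projMatrix_proj (A : HermPSD 𝕜 n r) : A.1 * projMatrix (proj A) = A.1 := by
  apply EquivLike.injective (Matrix.toEuclideanCLM (n := Fin n) (𝕜 := 𝕜))
  rw [map_mul, toEuclideanCLM_projMatrix]
  ext1 x
  have h1 := (proj A).1.sub_starProjection_mem_orthogonal x
  have h2 : x - (proj A).1.starProjection x ∈ LinearMap.ker (Matrix.toEuclideanLin A.1) := by
    have h3 : (proj A).1ᗮ = LinearMap.ker (Matrix.toEuclideanLin A.1) :=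
      Submodule.orthogonal_orthogonal _
    rwa [h3] at h1
  rw [LinearMap.mem_ker, map_sub, sub_eq_zero] at h2
  exact h2.symm

theorem projMatrix_proj_mul (A : HermPSD 𝕜 n r) : projMatrix (proj A) * A.1 = A.1 := by
  have := congrArg Matrix.conjTranspose (mul_projMatrix_proj A)
  rwa [Matrix.conjTranspose_mul, projMatrix_isHermitian, A.2.1.1] at this

/-- With `p` the projection of `A`: `h1` says that `1 - q` maps into the kernel of `A`, so `p = pq`;
`h2` applied to `1 - p` gives `q = qp`. Taking adjoints, `q = pq = p`. -/
theorem projMatrix_proj_eq (A : HermPSD 𝕜 n r) {q : Matrix (Fin n) (Fin n) 𝕜} (hq : qᴴ = q)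
    (h1 : A.1 * q = A.1) (h2 : ∀ N : Matrix (Fin n) (Fin n) 𝕜, A.1 * N = 0 → q * N = 0) :
    projMatrix (proj A) = q := by
  have h3 := projMatrix_proj_mul_eq_zero A (N := 1 - q) (by rw [Matrix.mul_sub, h1]; simp)
  have h4 := h2 (1 - projMatrix (proj A)) (by rw [Matrix.mul_sub, mul_projMatrix_proj]; simp)
  rw [Matrix.mul_sub, Matrix.mul_one, sub_eq_zero] at h3 h4
  rw [h3, ← projMatrix_isHermitian, ← hq, ← Matrix.conjTranspose_mul, ← h4]

/-- The conjugate `G A G*` of `A` by a unitary matrix `G`. -/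
def unitaryConj (A : HermPSD 𝕜 n r) (G : Matrix (Fin n) (Fin n) 𝕜) (hG : Gᴴ * G = 1) :
    HermPSD 𝕜 n r :=
  ⟨G * A.1 * Gᴴ, A.2.1.mul_mul_conjTranspose_same G, by
    have hG' : G * Gᴴ = 1 := mul_eq_one_comm.1 hG
    have hu : IsUnit G.det := (Matrix.isUnit_iff_isUnit_det G).1 ⟨⟨G, Gᴴ, hG', hG⟩, rfl⟩
    have hu' : IsUnit Gᴴ.det := (Matrix.isUnit_iff_isUnit_det Gᴴ).1 ⟨⟨Gᴴ, G, hG, hG'⟩, rfl⟩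
    rw [Matrix.rank_mul_eq_left_of_isUnit_det _ _ hu', Matrix.rank_mul_eq_right_of_isUnit_det _ _ hu]
    exact A.2.2⟩

theorem projMatrix_proj_unitaryConj (A : HermPSD 𝕜 n r) (G : Matrix (Fin n) (Fin n) 𝕜)
    (hG : Gᴴ * G = 1) :
    projMatrix (proj (unitaryConj A G hG)) = G * projMatrix (proj A) * Gᴴ := by
  have hG' : G * Gᴴ = 1 := mul_eq_one_comm.1 hG
  apply projMatrix_proj_eq
  · simp [projMatrix_isHermitian, Matrix.mul_assoc]
  · simp only [unitaryConj]
    rw [← Matrix.mul_assoc, ← Matrix.mul_assoc, Matrix.mul_assoc (G * A.1), hG, Matrix.mul_one,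
      Matrix.mul_assoc G, mul_projMatrix_proj]
  · intro N hN
    simp only [unitaryConj] at hN
    have h1 : A.1 * (Gᴴ * N) = 0 := by
      have := congrArg (Gᴴ * ·) hN
      simpa [← Matrix.mul_assoc, hG] using this
    rw [Matrix.mul_assoc, Matrix.mul_assoc, projMatrix_proj_mul_eq_zero A h1, Matrix.mul_zero]

end Frames

/-! ### Diagonalization and singular values -/

section Diagonalization

variable {𝕜 : Type*} [RCLike 𝕜] {n r s : ℕ}

variable (𝕜) in
/-- The diagonal matrix with real diagonal entries `d`. -/
noncomputable abbrev rdiag (d : Fin r → ℝ) : Matrix (Fin r) (Fin r) 𝕜 :=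
  Matrix.diagonal fun i => (d i : 𝕜)

theorem rdiag_mul (d e : Fin r → ℝ) : rdiag 𝕜 d * rdiag 𝕜 e = rdiag 𝕜 fun i => d i * e i := by
  simp [Matrix.diagonal_mul_diagonal]

theorem rdiag_conjTranspose (d : Fin r → ℝ) : (rdiag 𝕜 d)ᴴ = rdiag 𝕜 d := by
  rw [Matrix.diagonal_conjTranspose]
  congr 1
  funext i
  simp

theorem rdiag_sub (d e : Fin r → ℝ) : rdiag 𝕜 d - rdiag 𝕜 e = rdiag 𝕜 fun i => d i - e i := by
  simp

theorem rdiag_neg (d : Fin r → ℝ) : -rdiag 𝕜 d = rdiag 𝕜 fun i => -d i := by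
  rw [Matrix.diagonal_neg]
  congr 1
  funext i
  simp

theorem rdiag_one : rdiag 𝕜 (fun _ : Fin r => 1) = 1 := by
  ext i j
  simp [Matrix.diagonal_apply, Matrix.one_apply]

theorem rdiag_zero : rdiag 𝕜 (fun _ : Fin r => 0) = 0 := by
  ext i j
  simp [Matrix.diagonal_apply]

theorem re_trace_rdiag (d : Fin r → ℝ) : RCLike.re (rdiag 𝕜 d).trace = ∑ i, d i := by
  simp [Matrix.trace]

theorem rdiag_nonneg_of_eq {D : Matrix (Fin n) (Fin r) 𝕜} {d : Fin r → ℝ}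
    (h : Dᴴ * D = rdiag 𝕜 d) (i : Fin r) : 0 ≤ d i := by
  have h1 := congrArg RCLike.re (congrFun (congrFun h i) i)
  simp only [Matrix.diagonal_apply_eq, RCLike.ofReal_re, Matrix.mul_apply,
    Matrix.conjTranspose_apply, RCLike.star_def, RCLike.conj_mul] at h1
  rw [← h1, map_sum]
  exact Finset.sum_nonneg fun k _ => by rw [← RCLike.ofReal_pow, RCLike.ofReal_re]; positivity

theorem exists_unitary_diagonalize {M : Matrix (Fin r) (Fin r) 𝕜} (hM : M.IsHermitian) :
    ∃ (R : Matrix (Fin r) (Fin r) 𝕜) (d : Fin r → ℝ), Rᴴ * R = 1 ∧ Antitone d ∧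
      Rᴴ * M * R = rdiag 𝕜 d := by
  let τ : Equiv.Perm (Fin r) := Tuple.sort fun i => -hM.eigenvalues i
  have hτ := Tuple.monotone_sort fun i => -hM.eigenvalues i
  let Q : Matrix (Fin r) (Fin r) 𝕜 := hM.eigenvectorUnitary
  have hQ : Qᴴ * Q = 1 := Unitary.coe_star_mul_self hM.eigenvectorUnitary
  have hs : M = Q * Matrix.diagonal (RCLike.ofReal ∘ hM.eigenvalues) * Qᴴ := by
    conv_lhs => rw [hM.spectral_theorem]
    rw [Unitary.conjStarAlgAut_apply]
    rfl
  have hs' : Qᴴ * M * Q = Matrix.diagonal (RCLike.ofReal ∘ hM.eigenvalues) := by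
    have e : Qᴴ * (Q * Matrix.diagonal (RCLike.ofReal ∘ hM.eigenvalues) * Qᴴ) * Q =
        (Qᴴ * Q) * Matrix.diagonal (RCLike.ofReal ∘ hM.eigenvalues) * (Qᴴ * Q) := by
      simp only [Matrix.mul_assoc]
    rw [← hs, hQ, Matrix.one_mul, Matrix.mul_one] at e
    exact e
  refine ⟨Q.submatrix id τ, fun i => hM.eigenvalues (τ i), ?_, fun i j hij => ?_, ?_⟩
  · have e : (Q.submatrix id τ)ᴴ * Q.submatrix id τ = (Qᴴ * Q).submatrix τ τ := rfl
    rw [e, hQ, Matrix.submatrix_one_equiv]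
  · exact neg_le_neg_iff.1 (hτ hij)
  · have e : (Q.submatrix id τ)ᴴ * M * Q.submatrix id τ = (Qᴴ * M * Q).submatrix τ τ := rfl
    rw [e, hs', Matrix.submatrix_diagonal_equiv]
    rfl

/-- The columns of `D` are orthogonal of length `|σ i|`; `W` divides them by `σ i`. The convention
`0⁻¹ = 0` leaves zero columns where `σ i = 0`, so `W` is only a partial isometry. -/
theorem exists_mul_rdiag_eq {D : Matrix (Fin n) (Fin r) 𝕜} {σ : Fin r → ℝ}
    (h : Dᴴ * D = rdiag 𝕜 fun i => σ i ^ 2) :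
    ∃ W : Matrix (Fin n) (Fin r) 𝕜, W * rdiag 𝕜 σ = D ∧ W = D * rdiag 𝕜 (fun i => (σ i)⁻¹) ∧
      Wᴴ * W = rdiag 𝕜 fun i => if σ i = 0 then 0 else 1 := by
  refine ⟨D * rdiag 𝕜 (fun i => (σ i)⁻¹), ?_, rfl, ?_⟩
  · rw [← sub_eq_zero, ← Matrix.conjTranspose_mul_self_eq_zero]
    have e : D * rdiag 𝕜 (fun i => (σ i)⁻¹) * rdiag 𝕜 σ - D =
        D * rdiag 𝕜 fun i => (σ i)⁻¹ * σ i - 1 := by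
      rw [Matrix.mul_assoc, rdiag_mul, ← rdiag_sub, rdiag_one, Matrix.mul_sub, Matrix.mul_one]
    rw [e, Matrix.conjTranspose_mul, Matrix.mul_assoc, ← Matrix.mul_assoc Dᴴ, h,
      rdiag_conjTranspose, rdiag_mul, rdiag_mul, ← rdiag_zero]
    congr 1
    funext i
    by_cases hi : σ i = 0 <;> simp [hi]
  · rw [Matrix.conjTranspose_mul, Matrix.mul_assoc, ← Matrix.mul_assoc Dᴴ, h,
      rdiag_conjTranspose, rdiag_mul, rdiag_mul]
    congr 1
    funext i
    by_cases hi : σ i = 0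
    · simp [hi]
    · simp only [hi, if_false]
      field_simp

/-- In the square case the nonzero columns extend to an orthonormal basis; the new columns are
multiplied by `σ i = 0`, so their choice is immaterial. This supplies the second unitary of a
singular value decomposition. -/
theorem exists_unitary_mul_rdiag {D : Matrix (Fin r) (Fin r) 𝕜} {σ : Fin r → ℝ}
    (h : Dᴴ * D = rdiag 𝕜 fun i => σ i ^ 2) :
    ∃ S : Matrix (Fin r) (Fin r) 𝕜, Sᴴ * S = 1 ∧ S * rdiag 𝕜 σ = D := by
  obtain ⟨W, hW, -, hWW⟩ := exists_mul_rdiag_eq h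
  let f : Fin r → EuclideanSpace 𝕜 (Fin r) := fun i => WithLp.toLp 2 fun k => W k i
  have hf : frame f = W := rfl
  have ho : Orthonormal 𝕜 ({i | σ i ≠ 0}.domRestrict f) := by
    rw [orthonormal_iff_ite]
    rintro ⟨i, hi⟩ ⟨j, hj⟩
    have := inner_eq_frame f f i j
    rw [hf, hWW] at this
    simp only [Set.domRestrict_apply, Subtype.mk.injEq]
    refine this.trans ((Matrix.diagonal_apply _ i j).trans ?_)
    simp only [mem_ofPred_eq] at hi
    simp [hi]
  obtain ⟨b, hb⟩ := ho.exists_orthonormalBasis_extension_of_card_eq (by simp)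
  refine ⟨frame b, (orthonormal_iff_frame _).1 b.orthonormal, ?_⟩
  rw [← hW]
  ext k i
  rw [Matrix.mul_diagonal, Matrix.mul_diagonal]
  by_cases hi : σ i = 0
  · simp [hi]
  · rw [frame_apply, hb i hi]

/-- Similar matrices have the same characteristic polynomial, hence the same multiset of diagonal
entries, and sorting fixes their order. -/
theorem eq_of_unitary_conj_rdiag {d e : Fin r → ℝ} (hd : Antitone d) (he : Antitone e)
    {R : Matrix (Fin r) (Fin r) 𝕜} (hR : Rᴴ * R = 1) (h : Rᴴ * rdiag 𝕜 d * R = rdiag 𝕜 e) :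
    d = e := by
  have hR' : R * Rᴴ = 1 := mul_eq_one_comm.1 hR
  let u : (Matrix (Fin r) (Fin r) 𝕜)ˣ := ⟨Rᴴ, R, hR, hR'⟩
  have h1 : (rdiag 𝕜 d).charpoly = (rdiag 𝕜 e).charpoly := by
    have h2 := Matrix.charpoly_units_conj u (rdiag 𝕜 d)
    have h3 : (u : Matrix (Fin r) (Fin r) 𝕜)⁻¹ = R := Matrix.inv_eq_right_inv hR
    rw [h3] at h2
    rw [← h, ← h2]
  have h2 : ∀ f : Fin r → ℝ, ((rdiag 𝕜 f).charpoly.roots.map RCLike.re) = (List.ofFn f : Multiset ℝ) := by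
    intro f
    have : (rdiag 𝕜 f).charpoly =
        (Multiset.map (fun a => Polynomial.X - Polynomial.C a)
          (Multiset.map (fun i => (f i : 𝕜)) Finset.univ.val)).prod := by
      rw [Matrix.charpoly_diagonal, Multiset.map_map]
      rfl
    rw [this, Polynomial.roots_multiset_prod_X_sub_C, Multiset.map_map, Fin.univ_val_map]
    simp [Function.comp_def]
  have h3 : (List.ofFn d).Perm (List.ofFn e) := by
    rw [← Multiset.coe_eq_coe, ← h2, ← h2, h1]
  exact List.ofFn_injective (h3.eq_of_pairwise' hd.sortedGE_ofFn.pairwise he.sortedGE_ofFn.pairwise)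

/-- Existence of principal vectors. -/
theorem exists_principal_frames (U V : Gr 𝕜 r n) :
    ∃ (F H : Matrix (Fin n) (Fin r) 𝕜) (σ : Fin r → ℝ), Fᴴ * F = 1 ∧ F * Fᴴ = projMatrix U ∧
      Hᴴ * H = 1 ∧ H * Hᴴ = projMatrix V ∧ Antitone σ ∧ (∀ i, 0 ≤ σ i) ∧ Fᴴ * H = rdiag 𝕜 σ := by
  obtain ⟨F, hF, hFU⟩ := exists_frame U
  obtain ⟨H, hH, hHV⟩ := exists_frame V
  obtain ⟨R, d, hR, hd, hRd⟩ := exists_unitary_diagonalize (M := (Hᴴ * F)ᴴ * (Hᴴ * F))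
    (Matrix.isHermitian_conjTranspose_mul_self _)
  have hD : (Hᴴ * F * R)ᴴ * (Hᴴ * F * R) = rdiag 𝕜 d := by
    rw [← hRd]
    simp [Matrix.mul_assoc]
  have hd0 := rdiag_nonneg_of_eq hD
  obtain ⟨S, hS, hSD⟩ := exists_unitary_mul_rdiag (D := Hᴴ * F * R) (σ := fun i => √(d i)) (by
    rw [hD]
    congr 1
    funext i
    rw [Real.sq_sqrt (hd0 i)])
  have hR' : R * Rᴴ = 1 := mul_eq_one_comm.1 hR
  have hS' : S * Sᴴ = 1 := mul_eq_one_comm.1 hS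
  have key : ∀ (X : Matrix (Fin n) (Fin r) 𝕜) (T : Matrix (Fin r) (Fin r) 𝕜), Xᴴ * X = 1 →
      Tᴴ * T = 1 → T * Tᴴ = 1 → (X * T)ᴴ * (X * T) = 1 ∧ X * T * (X * T)ᴴ = X * Xᴴ := by
    intro X T hX hT hT'
    constructor
    · rw [Matrix.conjTranspose_mul, Matrix.mul_assoc, ← Matrix.mul_assoc Xᴴ, hX, Matrix.one_mul, hT]
    · rw [Matrix.conjTranspose_mul, Matrix.mul_assoc, ← Matrix.mul_assoc T, hT', Matrix.one_mul]
  refine ⟨F * R, H * S, fun i => √(d i), (key F R hF hR hR').1, (key F R hF hR hR').2.trans hFU,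
    (key H S hH hS hS').1, (key H S hH hS hS').2.trans hHV,
    fun i j hij => Real.sqrt_le_sqrt (hd hij), fun i => Real.sqrt_nonneg _, ?_⟩
  have : (H * S)ᴴ * (F * R) = rdiag 𝕜 fun i => √(d i) := by
    have e : (H * S)ᴴ * (F * R) = Sᴴ * (Hᴴ * F * R) := by simp [Matrix.mul_assoc]
    rw [e, ← hSD, ← Matrix.mul_assoc, hS, Matrix.one_mul]
  have := congrArg Matrix.conjTranspose this
  rwa [rdiag_conjTranspose, Matrix.conjTranspose_mul, Matrix.conjTranspose_conjTranspose] at this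

end Diagonalization

/-! ### Geodesics of the Grassmannian -/

section Geodesics

variable {𝕜 : Type*} [RCLike 𝕜] {n r s : ℕ}

theorem hasDerivWithinAt_unique {f : ℝ → Matrix (Fin n) (Fin n) 𝕜} {f₁ f₂ : Matrix (Fin n) (Fin n) 𝕜}
    {t : ℝ} (ht : t ∈ Icc (0 : ℝ) 1) (h₁ : HasDerivWithinAt f f₁ (Icc 0 1) t)
    (h₂ : HasDerivWithinAt f f₂ (Icc 0 1) t) : f₁ = f₂ :=
  (h₁.derivWithin (uniqueDiffOn_Icc zero_lt_one _ ht)).symm.trans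
    (h₂.derivWithin (uniqueDiffOn_Icc zero_lt_one _ ht))

theorem velocity_eq {c : ℝ → Matrix (Fin n) (Fin n) 𝕜} {c' : Matrix (Fin n) (Fin n) 𝕜} {t : ℝ}
    (ht : t ∈ Icc (0 : ℝ) 1) (h : HasDerivWithinAt c c' (Icc 0 1) t) : velocity c t = c' :=
  h.derivWithin (uniqueDiffOn_Icc zero_lt_one _ ht)

/-- Differentiate `P* = P` and `P² = P`. -/
theorem deriv_projMatrix {γ : ℝ → Gr 𝕜 r n} {p' : Matrix (Fin n) (Fin n) 𝕜} {t : ℝ}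
    (ht : t ∈ Icc (0 : ℝ) 1)
    (h : HasDerivWithinAt (fun τ => projMatrix (γ τ)) p' (Icc 0 1) t) :
    p'ᴴ = p' ∧ p' * projMatrix (γ t) + projMatrix (γ t) * p' = p' := by
  constructor
  · have := h.matrix_conjTranspose
    simp only [projMatrix_isHermitian] at this
    exact hasDerivWithinAt_unique ht this h
  · have := h.matrix_mul h
    simp only [projMatrix_mul_self] at this
    exact hasDerivWithinAt_unique ht this h

/-! ### Off-diagonal elements with respect to an idempotent -/

section Algebra

variable {R : Type*} [Ring R] {p x : R}

theorem proj_mul_mul_eq_zero (hp : p * p = p) (hx : x * p + p * x = x) : p * x * p = 0 := by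
  have h := congrArg (p * ·) hx
  simp only [mul_add, ← mul_assoc, hp] at h
  simpa using h

theorem commutator_mul_add (hp : p * p = p) (hx : x * p + p * x = x) :
    (x * p - p * x) * p + p * (x * p - p * x) = x * p - p * x := by
  have h := proj_mul_mul_eq_zero hp hx
  simp only [mul_sub, sub_mul, mul_assoc] at *
  simp only [hp, h, ← mul_assoc p p]
  abel

/-- Bracketing with `p` changes the sign of one off-diagonal block, so doing it twice is the
identity. Hence a velocity `x` at `p` is generated by `[x, p]`. -/
theorem commutator_commutator (hp : p * p = p) (hx : x * p + p * x = x) :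
    (x * p - p * x) * p - p * (x * p - p * x) = x := by
  have h := proj_mul_mul_eq_zero hp hx
  simp only [mul_sub, sub_mul, mul_assoc] at *
  simp only [hp, h, ← mul_assoc p p]
  simpa using hx

/-- An off-diagonal `x` interchanges the range and the kernel of `p`, so its square preserves both.
-/
theorem sq_commute (hx : x * p + p * x = x) : x * x * p = p * (x * x) := by
  have h1 : x * p = x - p * x := eq_sub_of_add_eq hx
  rw [mul_assoc, h1, mul_sub, ← mul_assoc, h1, sub_mul, mul_assoc p, sub_sub_cancel]

end Algebra

/-- The two off-diagonal blocks of `x` are adjoint, hence of equal norm, and `x F` sees only one of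
them. This is the factor `√2` in `grLength`. -/
theorem norm_sq_tangent {p x : Matrix (Fin n) (Fin n) 𝕜} (hx : xᴴ = x)
    (hxp : x * p + p * x = x) {F : Matrix (Fin n) (Fin r) 𝕜} (hF : F * Fᴴ = p) :
    ‖x‖ ^ 2 = 2 * ‖x * F‖ ^ 2 := by
  have e1 : ((x * F)ᴴ * (x * F)).trace = (x * p * x).trace := by
    rw [Matrix.trace_mul_comm, Matrix.conjTranspose_mul, hx, Matrix.mul_assoc x F,
      ← Matrix.mul_assoc F, hF, Matrix.mul_assoc]
  have e2 : (xᴴ * x).trace = 2 * (x * p * x).trace := by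
    rw [hx]
    nth_rewrite 2 [← hxp]
    rw [Matrix.mul_add, Matrix.trace_add, ← Matrix.mul_assoc, Matrix.mul_assoc x x p,
      Matrix.trace_mul_comm x (x * p), ← Matrix.mul_assoc, two_mul]
  rw [norm_sq_eq_re_trace, norm_sq_eq_re_trace, e1, e2]
  simp

/-- The space of generators of geodesics starting at `U`. -/
structure IsGenerator (U : Gr 𝕜 r n) (Ω : Matrix (Fin n) (Fin n) 𝕜) : Prop where
  skew : Ωᴴ = -Ω
  tangent : Ω * projMatrix U + projMatrix U * Ω = Ω

/-- `γ` is the orbit of `U` under the one-parameter group generated by `Ω`. -/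
def IsOrbit (U : Gr 𝕜 r n) (Ω : Matrix (Fin n) (Fin n) 𝕜) (γ : ℝ → Gr 𝕜 r n) : Prop :=
  ∀ t ∈ Icc (0 : ℝ) 1, projMatrix (γ t) =
    NormedSpace.exp (t • Ω) * projMatrix U * NormedSpace.exp (t • (-Ω))

theorem exp_smul_unitary {Ω : Matrix (Fin n) (Fin n) 𝕜} (h : Ωᴴ = -Ω) (t : ℝ) :
    (NormedSpace.exp (t • Ω))ᴴ * NormedSpace.exp (t • Ω) = 1 := by
  rw [conjTranspose_exp_smul h, exp_neg_smul_mul]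

theorem exists_orbit {U : Gr 𝕜 r n} {Ω : Matrix (Fin n) (Fin n) 𝕜} (hΩ : Ωᴴ = -Ω) :
    ∃ γ : ℝ → Gr 𝕜 r n, IsOrbit U Ω γ := by
  obtain ⟨F, hF, hFU⟩ := exists_frame U
  have : ∀ t : ℝ, ∃ V : Gr 𝕜 r n, projMatrix V =
      NormedSpace.exp (t • Ω) * projMatrix U * NormedSpace.exp (t • (-Ω)) := by
    intro t
    obtain ⟨V, hV⟩ := exists_projMatrix_eq (NormedSpace.exp (t • Ω) * F) (by
      rw [Matrix.conjTranspose_mul, Matrix.mul_assoc, ← Matrix.mul_assoc (NormedSpace.exp _)ᴴ,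
        exp_smul_unitary hΩ, Matrix.one_mul, hF])
    refine ⟨V, ?_⟩
    rw [hV, Matrix.conjTranspose_mul, conjTranspose_exp_smul hΩ, ← hFU]
    simp only [Matrix.mul_assoc]
  choose γ hγ using this
  exact ⟨γ, fun t _ => hγ t⟩

namespace IsOrbit

variable {U : Gr 𝕜 r n} {Ω : Matrix (Fin n) (Fin n) 𝕜} {γ : ℝ → Gr 𝕜 r n}

theorem apply_zero (h : IsOrbit U Ω γ) : γ 0 = U :=
  projMatrix_injective (by simpa using h 0 (by simp))

theorem hasDerivWithinAt (h : IsOrbit U Ω γ) {t : ℝ} (ht : t ∈ Icc (0 : ℝ) 1) :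
    HasDerivWithinAt (fun τ => projMatrix (γ τ))
      (Ω * projMatrix (γ t) - projMatrix (γ t) * Ω) (Icc 0 1) t := by
  rw [h t ht]
  exact (hasDerivAt_conj_exp Ω (projMatrix U) t).hasDerivWithinAt.congr h (h t ht)

theorem contDiffOn (h : IsOrbit U Ω γ) {k : WithTop ℕ∞} : IsGrCurve k γ :=
  ContDiffOn.congr (((contDiff_exp_smul Ω).contDiffOn.matrix_mul contDiffOn_const).matrix_mul
    (contDiff_exp_smul (-Ω)).contDiffOn) h

theorem isGenerator (h : IsOrbit U Ω γ) (hΩ : IsGenerator U Ω) {t : ℝ} (ht : t ∈ Icc (0 : ℝ) 1) :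
    IsGenerator (γ t) Ω := by
  refine ⟨hΩ.skew, ?_⟩
  have h1 : Commute Ω (NormedSpace.exp (t • Ω)) := ((Commute.refl Ω).smul_right t).exp_right
  have h2 : Commute Ω (NormedSpace.exp (t • (-Ω))) :=
    (((Commute.refl Ω).neg_right).smul_right t).exp_right
  rw [h t ht]
  have e1 : Ω * (NormedSpace.exp (t • Ω) * projMatrix U * NormedSpace.exp (t • (-Ω))) =
      NormedSpace.exp (t • Ω) * (Ω * projMatrix U) * NormedSpace.exp (t • (-Ω)) := by
    simp only [← Matrix.mul_assoc]
    rw [h1.eq]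
  have e2 : (NormedSpace.exp (t • Ω) * projMatrix U * NormedSpace.exp (t • (-Ω))) * Ω =
      NormedSpace.exp (t • Ω) * (projMatrix U * Ω) * NormedSpace.exp (t • (-Ω)) := by
    simp only [Matrix.mul_assoc]
    rw [h2.eq]
  rw [e1, e2, ← Matrix.add_mul, ← Matrix.mul_add, hΩ.tangent, ← h1.eq, Matrix.mul_assoc,
    exp_mul_neg_smul, Matrix.mul_one]

theorem isGeodesic (h : IsOrbit U Ω γ) (hΩ : IsGenerator U Ω) : IsGeodesic γ := by
  refine ⟨h.contDiffOn, ?_⟩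
  rintro t ht X ⟨hX, hXp⟩
  have hu := uniqueDiffOn_Icc (zero_lt_one' ℝ)
  set P : ℝ → Matrix (Fin n) (Fin n) 𝕜 := fun τ => projMatrix (γ τ) with hP
  have hd : ∀ τ ∈ Icc (0 : ℝ) 1, derivWithin P (Icc 0 1) τ = Ω * P τ - P τ * Ω := fun τ hτ =>
    (h.hasDerivWithinAt hτ).derivWithin (hu τ hτ)
  have h2 : iteratedDerivWithin 2 P (Icc 0 1) t =
      Ω * (Ω * P t - P t * Ω) - (Ω * P t - P t * Ω) * Ω := by
    rw [iteratedDerivWithin_succ, iteratedDerivWithin_one]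
    refine (derivWithin_congr hd (hd t ht)).trans ?_
    exact ((((h.hasDerivWithinAt ht).matrix_const_mul Ω).sub
      ((h.hasDerivWithinAt ht).matrix_mul_const Ω)).congr_deriv rfl).derivWithin (hu t ht)
  rw [h2, hX.eq]
  have hp : P t * P t = P t := projMatrix_mul_self _
  have hΩt : Ω * P t + P t * Ω = Ω := (h.isGenerator hΩ ht).tangent
  have hXp' : X * P t + P t * X = X := hXp
  have hXz := proj_mul_mul_eq_zero hp hXp'
  have hz := proj_mul_mul_eq_zero hp hΩt
  have hc := sq_commute hΩt
  set Z := Ω * (Ω * P t - P t * Ω) - (Ω * P t - P t * Ω) * Ω with hZ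
  -- The acceleration `[Ω, [Ω, P]]` is block-diagonal, being built from two off-diagonal factors
  -- `Ω`; block-diagonal matrices are trace-orthogonal to off-diagonal `X`.
  have hZc : Z * P t = P t * Z := by
    have e1 : Ω * P t = Ω - P t * Ω := eq_sub_of_add_eq hΩt
    have e2 : Ω * P t * Ω = Ω * Ω - P t * (Ω * Ω) := by rw [e1, Matrix.sub_mul, Matrix.mul_assoc]
    have e3 : Z = P t * (Ω * Ω) + P t * (Ω * Ω) - (Ω * P t * Ω + Ω * P t * Ω) := by
      rw [hZ, Matrix.mul_sub, Matrix.sub_mul, ← Matrix.mul_assoc, hc]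
      simp only [Matrix.mul_assoc]
      abel
    rw [e3, e2]
    simp only [Matrix.mul_sub, Matrix.sub_mul, Matrix.mul_add, Matrix.add_mul, Matrix.mul_assoc]
    rw [← Matrix.mul_assoc Ω Ω, hc]
  have t1 : (X * P t * Z).trace = 0 := by
    rw [← hp, ← Matrix.mul_assoc, Matrix.mul_assoc, ← hZc, ← Matrix.mul_assoc,
      Matrix.trace_mul_comm, ← Matrix.mul_assoc, ← Matrix.mul_assoc, hXz]
    simp
  have t2 : (P t * X * Z).trace = 0 := by
    rw [← hp, Matrix.mul_assoc (P t) (P t), Matrix.mul_assoc (P t), Matrix.trace_mul_comm,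
      Matrix.mul_assoc, hZc, ← Matrix.mul_assoc, hXz]
    simp
  have : X * Z = X * P t * Z + P t * X * Z := by rw [← Matrix.add_mul, hXp']
  rw [this, Matrix.trace_add, t1, t2]
  simp

theorem grLength_eq (h : IsOrbit U Ω γ) (hΩ : IsGenerator U Ω) {F : Matrix (Fin n) (Fin r) 𝕜}
    (hF : Fᴴ * F = 1) (hFU : F * Fᴴ = projMatrix U) : grLength γ = ‖Ω * F‖ := by
  have hv : ∀ t ∈ uIcc (0 : ℝ) 1, ‖velocity (fun τ => projMatrix (γ τ)) t‖ / √2 = ‖Ω * F‖ := by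
    intro t ht
    rw [uIcc_of_le zero_le_one] at ht
    rw [velocity_eq ht (h.hasDerivWithinAt ht)]
    have hG := h.isGenerator hΩ ht
    have hE := exp_smul_unitary hΩ.skew t
    set E := NormedSpace.exp (t • Ω) with hEdef
    have h1 : Commute Ω E := ((Commute.refl Ω).smul_right t).exp_right
    have hEF : (E * F) * (E * F)ᴴ = projMatrix (γ t) := by
      rw [h t ht, Matrix.conjTranspose_mul, conjTranspose_exp_smul hΩ.skew, ← hFU]
      simp only [Matrix.mul_assoc, hEdef]
    have hEF1 : (E * F)ᴴ * (E * F) = 1 := by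
      rw [Matrix.conjTranspose_mul, Matrix.mul_assoc, ← Matrix.mul_assoc Eᴴ, hE, Matrix.one_mul, hF]
    have hpF : projMatrix (γ t) * (E * F) = E * F := by
      rw [← hEF, Matrix.mul_assoc, hEF1, Matrix.mul_one]
    have hx := deriv_projMatrix ht (h.hasDerivWithinAt ht)
    have h2 := norm_sq_tangent hx.1 hx.2 hEF
    -- The velocity acts on the moved frame `E F` as `Ω` does, and `Ω` commutes with `E`; so the
    -- speed is constant.
    have h3 : (Ω * projMatrix (γ t) - projMatrix (γ t) * Ω) * (E * F) = E * (Ω * F) := by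
      have hz := proj_mul_mul_eq_zero (projMatrix_mul_self (γ t)) hG.tangent
      have e : projMatrix (γ t) * Ω * (E * F) = 0 := by
        rw [← hpF, ← Matrix.mul_assoc, hz, Matrix.zero_mul]
      rw [Matrix.sub_mul, e, sub_zero, Matrix.mul_assoc, hpF, ← Matrix.mul_assoc, h1.eq,
        Matrix.mul_assoc]
    rw [h3, norm_isometry_mul E hE] at h2
    rw [div_eq_iff (by positivity), ← sq_eq_sq₀ (norm_nonneg _) (by positivity), h2, mul_pow,
      Real.sq_sqrt zero_le_two, mul_comm]
  rw [grLength, intervalIntegral.integral_congr hv]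
  simp

end IsOrbit

theorem IsGeodesic.exists_isOrbit {γ : ℝ → Gr 𝕜 r n} (h : IsGeodesic γ) :
    ∃ Ω, IsGenerator (γ 0) Ω ∧ IsOrbit (γ 0) Ω γ := by
  obtain ⟨hC, hN⟩ := h
  have hu := uniqueDiffOn_Icc (zero_lt_one' ℝ)
  set P : ℝ → Matrix (Fin n) (Fin n) 𝕜 := fun τ => projMatrix (γ τ) with hP
  set P' : ℝ → Matrix (Fin n) (Fin n) 𝕜 := derivWithin P (Icc 0 1) with hP'
  have hd : ∀ t ∈ Icc (0 : ℝ) 1, HasDerivWithinAt P (P' t) (Icc 0 1) t := fun t ht =>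
    (hC.differentiableOn (by simp) t ht).hasDerivWithinAt
  have hC' : ContDiffOn ℝ 1 P' (Icc 0 1) :=
    ContDiffOn.derivWithin hC hu (by exact WithTop.coe_le_coe.2 le_top)
  have hd' : ∀ t ∈ Icc (0 : ℝ) 1,
      HasDerivWithinAt P' (iteratedDerivWithin 2 P (Icc 0 1) t) (Icc 0 1) t := by
    intro t ht
    have := (hC'.differentiableOn one_ne_zero t ht).hasDerivWithinAt
    rwa [iteratedDerivWithin_succ, iteratedDerivWithin_one]
  have hcomm : ∀ t ∈ Icc (0 : ℝ) 1, iteratedDerivWithin 2 P (Icc 0 1) t * P t =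
      P t * iteratedDerivWithin 2 P (Icc 0 1) t := by
    intro t ht
    set Z := iteratedDerivWithin 2 P (Icc 0 1) t with hZ
    have hp : P t * P t = P t := projMatrix_mul_self _
    have hph : (P t)ᴴ = P t := projMatrix_isHermitian _
    have hZh : Zᴴ = Z := by
      have h1 := (hd' t ht).matrix_conjTranspose
      have h2 : HasDerivWithinAt P' Zᴴ (Icc 0 1) t := h1.congr
        (fun τ hτ => (deriv_projMatrix hτ (hd τ hτ)).1.symm) (deriv_projMatrix ht (hd t ht)).1.symm
      exact hasDerivWithinAt_unique ht h2 (hd' t ht)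
    -- `X` is the tangential part of the acceleration `Z`. Testing the geodesic condition against
    -- `X` itself gives `‖X‖² = 0`, so `Z` is block-diagonal.
    set X := P t * Z + Z * P t - (P t * Z * P t + P t * Z * P t) with hX
    have hXh : Xᴴ = X := by
      simp only [hX, Matrix.conjTranspose_sub, Matrix.conjTranspose_add, Matrix.conjTranspose_mul,
        hZh, hph, Matrix.mul_assoc]
      abel
    have e1 : P t * X = P t * Z - P t * Z * P t := by
      rw [hX]
      simp only [Matrix.mul_sub, Matrix.mul_add, ← Matrix.mul_assoc, hp]
      abel
    have e2 : X * P t = Z * P t - P t * Z * P t := by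
      rw [hX]
      simp only [Matrix.sub_mul, Matrix.add_mul, Matrix.mul_assoc, hp]
      abel
    have hXt : X * P t + P t * X = X := by
      rw [e1, e2, hX]
      abel
    have hXz := proj_mul_mul_eq_zero hp hXt
    have h0 := hN t ht X ⟨hXh, hXt⟩
    have hX0 : X = 0 := by
      rw [← norm_eq_zero, ← sq_eq_zero_iff, norm_sq_eq_re_trace, ← h0, hXh]
      congr 1
      have e3 : (X * X).trace = (X * (P t * Z)).trace + (X * (Z * P t)).trace -
          ((X * (P t * Z * P t)).trace + (X * (P t * Z * P t)).trace) := by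
        nth_rewrite 2 [hX]
        simp only [Matrix.mul_sub, Matrix.mul_add, Matrix.trace_sub, Matrix.trace_add]
      have e4 : (X * (Z * P t)).trace = (P t * X * Z).trace := by
        rw [← Matrix.mul_assoc, Matrix.trace_mul_comm, ← Matrix.mul_assoc]
      have e5 : (X * (P t * Z * P t)).trace = 0 := by
        rw [← Matrix.mul_assoc, Matrix.trace_mul_comm, ← Matrix.mul_assoc, ← Matrix.mul_assoc, hXz]
        simp
      rw [e3, e4, e5, ← Matrix.mul_assoc, add_zero, sub_zero, ← Matrix.trace_add, ← Matrix.add_mul,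
        hXt]
    rw [hX0, Matrix.mul_zero] at e1
    rw [hX0, Matrix.zero_mul] at e2
    rw [sub_eq_zero.1 e1.symm, sub_eq_zero.1 e2.symm]
  -- The derivative of `[P', P]` is `[P'', P]`, which has just been shown to vanish.
  have hΩc := eq_of_hasDerivWithinAt_zero (f := fun t => P' t * P t - P t * P' t) fun t ht =>
    (((hd' t ht).matrix_mul (hd t ht)).sub ((hd t ht).matrix_mul (hd' t ht))).congr_deriv (by
      rw [hcomm t ht]; abel)
  have h0 : (0 : ℝ) ∈ Icc (0 : ℝ) 1 := by simp
  have hdp := fun t ht => deriv_projMatrix ht (hd t ht)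
  refine ⟨P' 0 * P 0 - P 0 * P' 0, ⟨?_, commutator_mul_add (projMatrix_mul_self _) (hdp 0 h0).2⟩, ?_⟩
  · have hph : (P 0)ᴴ = P 0 := projMatrix_isHermitian _
    rw [Matrix.conjTranspose_sub, Matrix.conjTranspose_mul, Matrix.conjTranspose_mul, hph,
      (hdp 0 h0).1, neg_sub]
  · refine eq_exp_smul_mul_mul (X := P) fun t ht => (hd t ht).congr_deriv ?_
    rw [← hΩc t ht]
    exact (commutator_commutator (projMatrix_mul_self _) (hdp t ht).2).symm

end Geodesics

/-! ### The lower bound for lengths of curves in the Grassmannian -/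

section LowerBound

variable {𝕜 : Type*} [RCLike 𝕜] {n r s : ℕ}

/-- Subtracting from `a` its real component along `y` does not change the real inner product with
`z`; the remainder has length `√(1 - f²)`, and Cauchy-Schwarz applies. Geometrically, the angle
between `a` and a point `y` of the unit sphere changes at most at the speed of `y`. -/
theorem abs_re_inner_le {E : Type*} [NormedAddCommGroup E] [InnerProductSpace 𝕜 E] {a y z : E}
    (ha : ‖a‖ = 1) (hy : ‖y‖ = 1) (hyz : RCLike.re (inner 𝕜 y z) = 0) :
    |RCLike.re (inner 𝕜 a z)| ≤ √(1 - RCLike.re (inner 𝕜 a y) ^ 2) * ‖z‖ := by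
  set f : ℝ := RCLike.re (inner 𝕜 a y) with hf
  have h1 : RCLike.re (inner 𝕜 (a - (f : 𝕜) • y) z) = RCLike.re (inner 𝕜 a z) := by
    rw [inner_sub_left, inner_smul_left, map_sub, RCLike.conj_ofReal, RCLike.re_ofReal_mul, hyz]
    simp
  have h2 : ‖a - (f : 𝕜) • y‖ ^ 2 = 1 - f ^ 2 := by
    rw [@norm_sub_sq 𝕜, inner_smul_right, RCLike.re_ofReal_mul, ← hf, norm_smul, ha, hy,
      RCLike.norm_ofReal, mul_one, sq_abs]
    ring
  rw [← h1, ← h2, Real.sqrt_sq (norm_nonneg _)]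
  exact (RCLike.abs_re_le_norm _).trans (norm_inner_le_norm _ _)

/-- The `i`-th column of a matrix. -/
def euclideanCol (X : Matrix (Fin n) (Fin r) 𝕜) (i : Fin r) : EuclideanSpace 𝕜 (Fin n) :=
  WithLp.toLp 2 fun k => X k i

theorem inner_euclideanCol (X : Matrix (Fin n) (Fin r) 𝕜) (Y : Matrix (Fin n) (Fin s) 𝕜)
    (i : Fin r) (j : Fin s) :
    inner 𝕜 (euclideanCol X i) (euclideanCol Y j) = (Xᴴ * Y) i j :=
  inner_eq_frame _ _ i j

theorem norm_euclideanCol {X : Matrix (Fin n) (Fin r) 𝕜} (hX : Xᴴ * X = 1) (i : Fin r) :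
    ‖euclideanCol X i‖ = 1 := by
  rw [← sq_eq_sq₀ (norm_nonneg _) zero_le_one, norm_sq_eq_re_inner (𝕜 := 𝕜), inner_euclideanCol, hX]
  simp

theorem sum_norm_sq_euclideanCol (X : Matrix (Fin n) (Fin r) 𝕜) :
    ∑ i, ‖euclideanCol X i‖ ^ 2 = ‖X‖ ^ 2 := by
  rw [norm_sq_eq_re_trace, Matrix.trace, map_sum]
  refine Finset.sum_congr rfl fun i _ => ?_
  rw [norm_sq_eq_re_inner (𝕜 := 𝕜), inner_euclideanCol]
  rfl

/-- Horizontal lifts of `C¹` curves in the Grassmannian. -/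
theorem exists_horizontal_lift {γ : ℝ → Gr 𝕜 r n} (hγ : IsGrCurve 1 γ)
    {F : Matrix (Fin n) (Fin r) 𝕜} (hF : Fᴴ * F = 1) (hFU : F * Fᴴ = projMatrix (γ 0)) :
    ∃ Y Y' : ℝ → Matrix (Fin n) (Fin r) 𝕜, Y 0 = F ∧ ∀ t ∈ Icc (0 : ℝ) 1,
      (Y t)ᴴ * Y t = 1 ∧ Y t * (Y t)ᴴ = projMatrix (γ t) ∧ (Y t)ᴴ * Y' t = 0 ∧
      HasDerivWithinAt Y (Y' t) (Icc 0 1) t ∧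
      ‖Y' t‖ = ‖velocity (fun τ => projMatrix (γ τ)) t‖ / √2 := by
  have hu := uniqueDiffOn_Icc (zero_lt_one' ℝ)
  set P : ℝ → Matrix (Fin n) (Fin n) 𝕜 := fun τ => projMatrix (γ τ) with hP
  set P' : ℝ → Matrix (Fin n) (Fin n) 𝕜 := velocity P with hP'
  have hd : ∀ t ∈ Icc (0 : ℝ) 1, HasDerivWithinAt P (P' t) (Icc 0 1) t := fun t ht =>
    (hγ.differentiableOn one_ne_zero t ht).hasDerivWithinAt
  have hPc : ContinuousOn P (Icc 0 1) := hγ.continuousOn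
  have hP'c : ContinuousOn P' (Icc 0 1) := hγ.continuousOn_derivWithin hu le_rfl
  have hdp := fun t ht => deriv_projMatrix ht (hd t ht)
  have hph : ∀ t, (P t)ᴴ = P t := fun t => projMatrix_isHermitian _
  have hpp : ∀ t, P t * P t = P t := fun t => projMatrix_mul_self _
  -- The flow of `[P', P]` carries `P 0` to `P t`, since `[[P', P], P] = P'`. It moves the frame by
  -- `Y' = P' Y`, which is orthogonal to the range of `P`.
  obtain ⟨G, hG0, hG⟩ := exists_unitary_flow (fun t => P' t * P t - P t * P' t)
    ((hP'c.mul hPc).sub (hPc.mul hP'c)) (fun t ht => by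
      rw [Matrix.conjTranspose_sub, Matrix.conjTranspose_mul, Matrix.conjTranspose_mul, hph,
        (hdp t ht).1, neg_sub])
  have hPG : ∀ t ∈ Icc (0 : ℝ) 1, P t = G t * P 0 * (G t)ᴴ := by
    intro t ht
    have := eq_of_hasDerivWithinAt_zero (f := fun t => (G t)ᴴ * P t * G t) (fun t ht => by
      refine (((hG t ht).2.matrix_conjTranspose.matrix_mul (hd t ht)).matrix_mul
        (hG t ht).2).congr_deriv ?_
      have hc := commutator_commutator (hpp t) (hdp t ht).2
      have hsk : (P' t * P t - P t * P' t)ᴴ = -(P' t * P t - P t * P' t) := by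
        rw [Matrix.conjTranspose_sub, Matrix.conjTranspose_mul, Matrix.conjTranspose_mul, hph,
          (hdp t ht).1, neg_sub]
      rw [Matrix.conjTranspose_mul, hsk]
      nth_rewrite 3 [← hc]
      simp only [Matrix.mul_sub, Matrix.sub_mul, Matrix.add_mul, Matrix.mul_assoc, Matrix.mul_neg,
        Matrix.neg_mul]
      abel) t ht
    have hGG : G t * (G t)ᴴ = 1 := mul_eq_one_comm.1 (hG t ht).1
    simp only [hG0, Matrix.conjTranspose_one, Matrix.one_mul, Matrix.mul_one] at this
    rw [← this]
    calc P t = (G t * (G t)ᴴ) * P t * (G t * (G t)ᴴ) := by simp [hGG]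
      _ = _ := by simp only [Matrix.mul_assoc]
  have hY1 : ∀ t ∈ Icc (0 : ℝ) 1, (G t * F)ᴴ * (G t * F) = 1 := fun t ht => by
    rw [Matrix.conjTranspose_mul, Matrix.mul_assoc, ← Matrix.mul_assoc (G t)ᴴ, (hG t ht).1,
      Matrix.one_mul, hF]
  have hY2 : ∀ t ∈ Icc (0 : ℝ) 1, G t * F * (G t * F)ᴴ = P t := fun t ht => by
    rw [hPG t ht, Matrix.conjTranspose_mul, ← Matrix.mul_assoc, Matrix.mul_assoc (G t) F, hFU]
  have hPY : ∀ t ∈ Icc (0 : ℝ) 1, P t * (G t * F) = G t * F := fun t ht => by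
    rw [← hY2 t ht, Matrix.mul_assoc, hY1 t ht, Matrix.mul_one]
  have hYP : ∀ t ∈ Icc (0 : ℝ) 1, (G t * F)ᴴ * P t = (G t * F)ᴴ := fun t ht => by
    have := congrArg Matrix.conjTranspose (hPY t ht)
    rwa [Matrix.conjTranspose_mul, hph] at this
  have hY' : ∀ t ∈ Icc (0 : ℝ) 1,
      (P' t * P t - P t * P' t) * (G t * F) = P' t * (G t * F) := fun t ht => by
    have hz := proj_mul_mul_eq_zero (hpp t) (hdp t ht).2
    have e : P t * P' t * (G t * F) = 0 := by
      rw [← hPY t ht, ← Matrix.mul_assoc, hz, Matrix.zero_mul]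
    rw [Matrix.sub_mul, e, sub_zero, Matrix.mul_assoc, hPY t ht]
  refine ⟨fun t => G t * F, fun t => P' t * (G t * F), by simp [hG0], fun t ht =>
    ⟨hY1 t ht, hY2 t ht, ?_, ?_, ?_⟩⟩
  · have hz := proj_mul_mul_eq_zero (hpp t) (hdp t ht).2
    calc (G t * F)ᴴ * (P' t * (G t * F))
        = (G t * F)ᴴ * P t * (P' t * (P t * (G t * F))) := by rw [hYP t ht, hPY t ht]
      _ = (G t * F)ᴴ * (P t * P' t * P t) * (G t * F) := by simp only [Matrix.mul_assoc]
      _ = 0 := by rw [hz, Matrix.mul_zero, Matrix.zero_mul]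
  · refine ((hG t ht).2.matrix_mul_const F).congr_deriv ?_
    rw [Matrix.mul_assoc, hY' t ht]
  · have := norm_sq_tangent (hdp t ht).1 (hdp t ht).2 (hY2 t ht)
    rw [eq_div_iff (by positivity), ← sq_eq_sq₀ (by positivity) (norm_nonneg _), this, mul_pow,
      Real.sq_sqrt zero_le_two, mul_comm]

/-- Along the horizontal lift from `F`, the angle `arccos (f i)` between column `i` and its initial
position grows no faster than the speed of that column. Weighting by `θ i` and using Cauchy-Schwarz
over `i` bounds the rate of `∑ θ i arccos (f i)` by `T` times the speed of the curve. The final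
angles are at least `θ i`, so `T² ≤ T L`. -/
theorem sqrt_sum_arccos_sq_le_grLength {U V : Gr 𝕜 r n} {F H : Matrix (Fin n) (Fin r) 𝕜}
    (hF : Fᴴ * F = 1) (hFU : F * Fᴴ = projMatrix U) (hH : Hᴴ * H = 1) (hHV : H * Hᴴ = projMatrix V)
    {σ : Fin r → ℝ} (hσ0 : ∀ i, 0 ≤ σ i) (hσ : Fᴴ * H = rdiag 𝕜 σ)
    {γ : ℝ → Gr 𝕜 r n} (hγ : IsGrCurve 1 γ) (h0 : γ 0 = U) (h1 : γ 1 = V) :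
    √(∑ i, Real.arccos (σ i) ^ 2) ≤ grLength γ := by
  obtain ⟨Y, Y', hY0, hY⟩ := exists_horizontal_lift hγ hF (by rw [hFU, h0])
  set N : ℝ → ℝ := fun t => ‖velocity (fun τ => projMatrix (γ τ)) t‖ / √2 with hN
  set L := grLength γ with hL
  have hLN : L = ∫ t in (0 : ℝ)..1, N t := rfl
  have hNc : ContinuousOn N (Icc 0 1) :=
    (hγ.continuousOn_derivWithin (uniqueDiffOn_Icc zero_lt_one) le_rfl).norm.div_const _
  have hL0 : 0 ≤ L := intervalIntegral.integral_nonneg zero_le_one fun t _ => by positivity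
  set θ : Fin r → ℝ := fun i => Real.arccos (σ i) with hθ
  have hθ0 : ∀ i, 0 ≤ θ i := fun i => Real.arccos_nonneg _
  set T := √(∑ i, θ i ^ 2) with hT
  let f : Fin r → ℝ → ℝ := fun i t => RCLike.re ((Fᴴ * Y t) i i)
  have hfd : ∀ i, ∀ t ∈ Icc (0 : ℝ) 1,
      HasDerivWithinAt (f i) (RCLike.re ((Fᴴ * Y' t) i i)) (Icc 0 1) t := by
    intro i t ht
    have h2 := hasDerivWithinAt_matrix.1 ((hY t ht).2.2.2.1.matrix_const_mul Fᴴ) i i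
    exact (RCLike.reCLM (K := 𝕜)).hasFDerivAt.comp_hasDerivWithinAt t h2
  have hf1 : ∀ i, ∀ t ∈ Icc (0 : ℝ) 1, |f i t| ≤ 1 := by
    intro i t ht
    simp only [f]
    rw [← inner_euclideanCol]
    refine (RCLike.abs_re_le_norm _).trans ((norm_inner_le_norm _ _).trans ?_)
    rw [norm_euclideanCol hF, norm_euclideanCol (hY t ht).1, one_mul]
  have hfd' : ∀ i, ∀ t ∈ Icc (0 : ℝ) 1,
      |RCLike.re ((Fᴴ * Y' t) i i)| ≤ √(1 - f i t ^ 2) * ‖euclideanCol (Y' t) i‖ := by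
    intro i t ht
    simp only [f]
    rw [← inner_euclideanCol, ← inner_euclideanCol]
    apply abs_re_inner_le (norm_euclideanCol hF i) (norm_euclideanCol (hY t ht).1 i)
    rw [inner_euclideanCol, (hY t ht).2.2.1]
    simp
  -- The columns of `Y 1` lie in `V`, so `F* Y(1) = σ H* Y(1)`; the diagonal entries of `H* Y(1)`
  -- are inner products of unit vectors.
  have hfσ : ∀ i, f i 1 ≤ σ i := by
    intro i
    have hY1 := hY 1 (by simp)
    have e : Fᴴ * Y 1 = rdiag 𝕜 σ * (Hᴴ * Y 1) := by
      have hPY : projMatrix (γ 1) * Y 1 = Y 1 := by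
        rw [← hY1.2.1, Matrix.mul_assoc, hY1.1, Matrix.mul_one]
      rw [← hσ, Matrix.mul_assoc, ← Matrix.mul_assoc H, hHV, ← h1, hPY]
    simp only [f]
    rw [e, Matrix.diagonal_mul, RCLike.re_ofReal_mul, ← inner_euclideanCol]
    refine mul_le_of_le_one_right (hσ0 i) ?_
    refine (RCLike.re_le_norm _).trans ((norm_inner_le_norm _ _).trans ?_)
    rw [norm_euclideanCol hH, norm_euclideanCol hY1.1, one_mul]
  -- `arccos` is not differentiable at `±1`, and `f i 0 = 1`. Scaling by `c < 1` avoids these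
  -- points; `c → 1` afterwards.
  have key : ∀ c ∈ Ioo (0 : ℝ) 1,
      ∑ i, θ i * (Real.arccos (c * σ i) - Real.arccos c) ≤ T * L := by
    intro c hc
    let g : ℝ → ℝ := fun t => ∑ i, θ i * Real.arccos (c * f i t)
    let g' : ℝ → ℝ := fun t => ∑ i, θ i *
      (-(1 / √(1 - (c * f i t) ^ 2)) * (c * RCLike.re ((Fᴴ * Y' t) i i)))
    have hcf : ∀ i, ∀ t ∈ Icc (0 : ℝ) 1, |c * f i t| < 1 := fun i t ht => by
      rw [abs_mul, abs_of_pos hc.1]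
      exact (mul_le_of_le_one_right hc.1.le (hf1 i t ht)).trans_lt hc.2
    have hg : ∀ t ∈ Icc (0 : ℝ) 1, HasDerivWithinAt g (g' t) (Icc 0 1) t := by
      intro t ht
      refine HasDerivWithinAt.fun_sum fun i _ => HasDerivWithinAt.const_mul _ ?_
      have h3 := abs_lt.1 (hcf i t ht)
      exact HasDerivAt.comp_hasDerivWithinAt (h₂ := Real.arccos) (h := fun t => c * f i t) t
        (Real.hasDerivAt_arccos h3.1.ne' h3.2.ne) ((hfd i t ht).const_mul c)
    have hg' : ∀ t ∈ Icc (0 : ℝ) 1, g' t ≤ T * N t := by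
      intro t ht
      have h3 : g' t ≤ ∑ i, θ i * ‖euclideanCol (Y' t) i‖ := by
        refine Finset.sum_le_sum fun i _ => mul_le_mul_of_nonneg_left ?_ (hθ0 i)
        have hpos : 0 < 1 - (c * f i t) ^ 2 := by
          rw [sub_pos, sq_lt_one_iff_abs_lt_one]
          exact hcf i t ht
        have h4 : c * √(1 - f i t ^ 2) ≤ √(1 - (c * f i t) ^ 2) := by
          apply Real.le_sqrt_of_sq_le
          rw [mul_pow, Real.sq_sqrt (by
            rw [sub_nonneg, sq_le_one_iff_abs_le_one]; exact hf1 i t ht)]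
          nlinarith [hc.1, hc.2]
        refine (le_abs_self _).trans ?_
        rw [abs_mul, abs_neg, abs_mul, abs_of_pos hc.1, abs_of_pos (by positivity),
          one_div, inv_mul_le_iff₀ (by positivity)]
        calc c * |RCLike.re ((Fᴴ * Y' t) i i)|
            ≤ c * (√(1 - f i t ^ 2) * ‖euclideanCol (Y' t) i‖) :=
              mul_le_mul_of_nonneg_left (hfd' i t ht) hc.1.le
          _ = c * √(1 - f i t ^ 2) * ‖euclideanCol (Y' t) i‖ := by ring
          _ ≤ _ := mul_le_mul_of_nonneg_right h4 (norm_nonneg _)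
      refine h3.trans ((Real.sum_mul_le_sqrt_mul_sqrt _ _ _).trans_eq ?_)
      rw [sum_norm_sq_euclideanCol, Real.sqrt_sq (norm_nonneg _), (hY t ht).2.2.2.2]
    have h5 := intervalIntegral.sub_le_integral_of_hasDeriv_right_of_le (g := g) (g' := g')
      (φ := fun t => T * N t) zero_le_one (fun t ht => (hg t ht).continuousWithinAt)
      (fun t ht => ((hg t (Ioo_subset_Icc_self ht)).hasDerivAt
        (Icc_mem_nhds ht.1 ht.2)).hasDerivWithinAt)
      (hNc.const_smul T).integrableOn_Icc (fun t ht => hg' t (Ioo_subset_Icc_self ht))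
    rw [intervalIntegral.integral_const_mul, ← hLN] at h5
    refine le_trans ?_ h5
    simp only [g]
    rw [← Finset.sum_sub_distrib]
    refine Finset.sum_le_sum fun i _ => ?_
    rw [← mul_sub]
    refine mul_le_mul_of_nonneg_left ?_ (hθ0 i)
    have h6 : f i 0 = 1 := by simp [f, hY0, hF]
    rw [h6, mul_one]
    exact sub_le_sub_right (Real.arccos_le_arccos (mul_le_mul_of_nonneg_left (hfσ i) hc.1.le)) _
  have hlim : ∑ i, θ i ^ 2 ≤ T * L := by
    have hcont : Continuous fun c : ℝ => ∑ i, θ i * (Real.arccos (c * σ i) - Real.arccos c) := by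
      refine continuous_finsetSum _ fun i _ => continuous_const.mul ?_
      exact (Real.continuous_arccos.comp (continuous_id.mul continuous_const)).sub
        Real.continuous_arccos
    have ht := (hcont.tendsto 1).mono_left (nhdsWithin_le_nhds (s := Iio 1))
    have h7 := le_of_tendsto ht (Filter.mem_of_superset
      (Ioo_mem_nhdsLT (zero_lt_one' ℝ)) key)
    simpa [pow_two] using h7
  rcases (Real.sqrt_nonneg (∑ i, θ i ^ 2)).eq_or_lt with hT0 | hT0
  · rw [← hT] at hT0
    rw [← hT0]
    exact hL0
  · have h8 : T * T ≤ T * L := by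
      rw [hT, Real.mul_self_sqrt (Finset.sum_nonneg fun i _ => sq_nonneg _), ← hT]
      exact hlim
    exact le_of_mul_le_mul_left h8 hT0

end LowerBound

/-! ### Minimizing geodesics and principal vectors -/

section Minimizing

variable {𝕜 : Type*} [RCLike 𝕜] {n r s : ℕ}

/-- `F` and `H` are orthonormal frames of `U` and `V` such that `F* H` is diagonal with
diagonal entries `σ ≥ 0`. -/
structure IsFramePair (U V : Gr 𝕜 r n) (F H : Matrix (Fin n) (Fin r) 𝕜) (σ : Fin r → ℝ) : Prop where
  left_isometry : Fᴴ * F = 1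
  left_range : F * Fᴴ = projMatrix U
  right_isometry : Hᴴ * H = 1
  right_range : H * Hᴴ = projMatrix V
  nonneg : ∀ i, 0 ≤ σ i
  diag : Fᴴ * H = rdiag 𝕜 σ

namespace IsFramePair

variable {U V : Gr 𝕜 r n} {F H : Matrix (Fin n) (Fin r) 𝕜} {σ : Fin r → ℝ}

theorem diag' (h : IsFramePair U V F H σ) : Hᴴ * F = rdiag 𝕜 σ := by
  have := congrArg Matrix.conjTranspose h.diag
  rwa [rdiag_conjTranspose, Matrix.conjTranspose_mul, Matrix.conjTranspose_conjTranspose] at this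

theorem difference (h : IsFramePair U V F H σ) :
    (H - F * rdiag 𝕜 σ)ᴴ * (H - F * rdiag 𝕜 σ) = rdiag 𝕜 fun i => 1 - σ i ^ 2 := by
  have e : (H - F * rdiag 𝕜 σ)ᴴ * (H - F * rdiag 𝕜 σ) = Hᴴ * H - Hᴴ * F * rdiag 𝕜 σ -
      (rdiag 𝕜 σ * (Fᴴ * H) - rdiag 𝕜 σ * (Fᴴ * F) * rdiag 𝕜 σ) := by
    rw [Matrix.conjTranspose_sub, Matrix.conjTranspose_mul, rdiag_conjTranspose]
    simp only [Matrix.sub_mul, Matrix.mul_sub, Matrix.mul_assoc]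
    abel
  rw [e, h.diag, h.diag', h.left_isometry, h.right_isometry, Matrix.mul_one, sub_self, sub_zero,
    rdiag_mul, ← rdiag_one, rdiag_sub]
  simp only [pow_two]

theorem le_one (h : IsFramePair U V F H σ) (i : Fin r) : σ i ≤ 1 := by
  have h1 := rdiag_nonneg_of_eq h.difference i
  nlinarith [h.nonneg i]

/-- With `θ = arccos σ`, normalizing the part of `H` orthogonal to `F` gives `H = F cos θ + W sin
θ`. The generator `Ω = W θ F* - F θ W*` rotates `F` towards `W` through the angles `θ`. -/
theorem exists_generator (h : IsFramePair U V F H σ) :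
    ∃ Ω, IsGenerator U Ω ∧ NormedSpace.exp Ω * F = H ∧
      ‖Ω * F‖ = √(∑ i, Real.arccos (σ i) ^ 2) := by
  set D := H - F * rdiag 𝕜 σ with hD
  set θ : Fin r → ℝ := fun i => Real.arccos (σ i) with hθ
  have hsin : ∀ i, Real.sin (θ i) ^ 2 = 1 - σ i ^ 2 := fun i => by
    rw [Real.sin_sq, Real.cos_arccos (by linarith [h.nonneg i]) (h.le_one i)]
  -- Zero columns of `W` are harmless: as `σ i ≥ 0`, a vanishing sine means angle 0 and not `π`.
  have hsin0 : ∀ i, Real.sin (θ i) = 0 → θ i = 0 := by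
    intro i hi
    have h1 := hsin i
    rw [hi] at h1
    have h2 : σ i = 1 := by nlinarith [h.nonneg i]
    simp [hθ, h2]
  obtain ⟨W, hWD, hW, hWW⟩ := exists_mul_rdiag_eq (D := D) (σ := fun i => Real.sin (θ i)) (by
    rw [hD, h.difference]
    simp only [hsin])
  have hFW : Fᴴ * W = 0 := by
    rw [hW, ← Matrix.mul_assoc, hD, Matrix.mul_sub, ← Matrix.mul_assoc, h.left_isometry, h.diag]
    simp
  have hWF : Wᴴ * F = 0 := by
    have := congrArg Matrix.conjTranspose hFW
    simpa using this
  have hθW : rdiag 𝕜 θ * (Wᴴ * W) = rdiag 𝕜 θ := by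
    rw [hWW, rdiag_mul]
    congr 1
    funext i
    by_cases hi : Real.sin (θ i) = 0 <;> simp [hi]
    simp [hsin0 i hi]
  set Ω := W * rdiag 𝕜 θ * Fᴴ - F * rdiag 𝕜 θ * Wᴴ with hΩ
  have hΩF : Ω * F = W * rdiag 𝕜 θ := by
    rw [hΩ, Matrix.sub_mul, Matrix.mul_assoc _ Fᴴ, h.left_isometry, Matrix.mul_assoc _ Wᴴ, hWF]
    simp
  have hΩW : Ω * W = -(F * rdiag 𝕜 θ) := by
    rw [hΩ, Matrix.sub_mul, Matrix.mul_assoc _ Fᴴ, hFW, Matrix.mul_assoc _ Wᴴ, Matrix.mul_assoc F,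
      hθW]
    simp
  have hskew : Ωᴴ = -Ω := by
    rw [hΩ, Matrix.conjTranspose_sub, Matrix.conjTranspose_mul, Matrix.conjTranspose_mul,
      Matrix.conjTranspose_mul, Matrix.conjTranspose_mul, rdiag_conjTranspose]
    simp only [Matrix.conjTranspose_conjTranspose, Matrix.mul_assoc]
    abel
  refine ⟨Ω, ⟨hskew, ?_⟩, ?_, ?_⟩
  · have e1 : Fᴴ * Ω = -(rdiag 𝕜 θ * Wᴴ) := by
      rw [hΩ, Matrix.mul_sub, ← Matrix.mul_assoc, ← Matrix.mul_assoc, ← Matrix.mul_assoc,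
        ← Matrix.mul_assoc, hFW, h.left_isometry]
      simp
    rw [← h.left_range, ← Matrix.mul_assoc, hΩF, Matrix.mul_assoc F, e1, hΩ, Matrix.mul_neg,
      ← sub_eq_add_neg, Matrix.mul_assoc F]
  · rw [exp_smul_mul_frame hΩF hΩW]
    have e2 : (fun i => ((Real.cos (θ i) : ℝ) : 𝕜)) = fun i => ((σ i : ℝ) : 𝕜) := by
      funext i
      rw [Real.cos_arccos (by linarith [h.nonneg i]) (h.le_one i)]
    rw [e2]
    have e3 : (W * Matrix.diagonal fun i => ((Real.sin (θ i) : ℝ) : 𝕜)) = D := hWD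
    rw [e3, hD]
    abel
  · rw [← Real.sqrt_sq (norm_nonneg (Ω * F)), norm_sq_eq_re_trace, hΩF, Matrix.conjTranspose_mul,
      rdiag_conjTranspose, Matrix.mul_assoc, ← Matrix.mul_assoc Wᴴ, ← Matrix.mul_assoc, hθW,
      rdiag_mul, re_trace_rdiag]
    simp only [pow_two, hθ]

theorem isOrbit_apply_one {γ : ℝ → Gr 𝕜 r n} {Ω : Matrix (Fin n) (Fin n) 𝕜}
    (h : IsFramePair U V F H σ) (hΩ : IsGenerator U Ω) (hΩF : NormedSpace.exp Ω * F = H)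
    (hγ : IsOrbit U Ω γ) : γ 1 = V := by
  apply projMatrix_injective
  have hs := conjTranspose_exp_smul hΩ.skew 1
  simp only [one_smul] at hs
  have h1 := hγ 1 (by simp)
  simp only [one_smul] at h1
  rw [h1, ← hs, ← h.left_range, ← h.right_range, ← hΩF, Matrix.conjTranspose_mul]
  simp only [Matrix.mul_assoc]

theorem grDist_eq (h : IsFramePair U V F H σ) : grDist U V = √(∑ i, Real.arccos (σ i) ^ 2) := by
  obtain ⟨Ω, hΩ, hΩF, hn⟩ := h.exists_generator
  obtain ⟨γ, hγ⟩ := exists_orbit (U := U) hΩ.skew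
  have hle : ∀ ℓ ∈ {ℓ | ∃ γ : ℝ → Gr 𝕜 r n, IsGrCurve 1 γ ∧ γ 0 = U ∧ γ 1 = V ∧ ℓ = grLength γ},
      √(∑ i, Real.arccos (σ i) ^ 2) ≤ ℓ := by
    rintro ℓ ⟨γ, hγ, h0, h1, rfl⟩
    exact sqrt_sum_arccos_sq_le_grLength h.left_isometry h.left_range h.right_isometry h.right_range
      h.nonneg h.diag hγ h0 h1
  have hmem : √(∑ i, Real.arccos (σ i) ^ 2) ∈
      {ℓ | ∃ γ : ℝ → Gr 𝕜 r n, IsGrCurve 1 γ ∧ γ 0 = U ∧ γ 1 = V ∧ ℓ = grLength γ} :=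
    ⟨γ, hγ.contDiffOn, hγ.apply_zero, h.isOrbit_apply_one hΩ hΩF hγ, by
      rw [hγ.grLength_eq hΩ h.left_isometry h.left_range, hn]⟩
  exact le_antisymm (csInf_le ⟨_, hle⟩ hmem) (le_csInf ⟨_, hmem⟩ hle)

theorem isMinGeodesic {γ : ℝ → Gr 𝕜 r n} {Ω : Matrix (Fin n) (Fin n) 𝕜}
    (h : IsFramePair U V F H σ) (hΩ : IsGenerator U Ω) (hΩF : NormedSpace.exp Ω * F = H)
    (hn : ‖Ω * F‖ = √(∑ i, Real.arccos (σ i) ^ 2)) (hγ : IsOrbit U Ω γ) :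
    IsMinGeodesic U V γ :=
  ⟨hγ.isGeodesic hΩ, hγ.apply_zero, h.isOrbit_apply_one hΩ hΩF hγ, by
    rw [hγ.grLength_eq hΩ h.left_isometry h.left_range, hn, h.grDist_eq]⟩

end IsFramePair

theorem exists_isFramePair (U V : Gr 𝕜 r n) : ∃ F H σ, IsFramePair U V F H σ ∧ Antitone σ := by
  obtain ⟨F, H, σ, h1, h2, h3, h4, h5, h6, h7⟩ := exists_principal_frames U V
  exact ⟨F, H, σ, ⟨h1, h2, h3, h4, h6, h7⟩, h5⟩

/-- The left side folds the angle into `[0, π/2]`; replacing a vector by its negative never costs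
length. -/
theorem arccos_abs_cos_le {x : ℝ} (hx : 0 ≤ x) : Real.arccos |Real.cos x| ≤ x := by
  rcases le_or_gt x (Real.pi / 2) with h | h
  · rw [abs_of_nonneg (Real.cos_nonneg_of_neg_pi_div_two_le_of_le (by linarith) h),
      Real.arccos_cos hx (by linarith)]
  · exact (Real.arccos_le_pi_div_two.2 (abs_nonneg _)).trans h.le

/-- Minimizing geodesics are generated by principal vectors. -/
theorem IsMinGeodesic.exists_isFramePair {U V : Gr 𝕜 r n} {γ : ℝ → Gr 𝕜 r n}
    (h : IsMinGeodesic U V γ) : ∃ Ω F H σ, IsGenerator U Ω ∧ IsOrbit U Ω γ ∧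
      IsFramePair U V F H σ ∧ Antitone σ ∧ NormedSpace.exp Ω * F = H := by
  obtain ⟨hg, h0, h1, hlen⟩ := h
  obtain ⟨Ω, hΩ, hγ⟩ := hg.exists_isOrbit
  rw [h0] at hΩ hγ
  obtain ⟨F₀, hF₀, hF₀U⟩ := exists_frame U
  -- `Ω²` preserves `U` and is negative semidefinite there; its eigenvectors are the directions
  -- rotated in independent planes, with eigenvalues `-θ i ^ 2`. Decreasing `d` makes the angles
  -- increase and their cosines decrease.
  obtain ⟨R, d, hR, hd, hRd⟩ := exists_unitary_diagonalize (M := F₀ᴴ * (Ω * Ω) * F₀) (by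
    simp only [Matrix.IsHermitian, Matrix.conjTranspose_mul, hΩ.skew,
      Matrix.conjTranspose_conjTranspose, Matrix.mul_assoc]
    simp)
  have hR' : R * Rᴴ = 1 := mul_eq_one_comm.1 hR
  set F := F₀ * R with hFdef
  have hF : Fᴴ * F = 1 := by
    rw [hFdef, Matrix.conjTranspose_mul, Matrix.mul_assoc, ← Matrix.mul_assoc F₀ᴴ, hF₀,
      Matrix.one_mul, hR]
  have hFU : F * Fᴴ = projMatrix U := by
    rw [hFdef, Matrix.conjTranspose_mul, Matrix.mul_assoc, ← Matrix.mul_assoc R, hR', Matrix.one_mul,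
      hF₀U]
  have hpF : projMatrix U * F = F := by rw [← hFU, Matrix.mul_assoc, hF, Matrix.mul_one]
  have hFp : Fᴴ * projMatrix U = Fᴴ := by rw [← hFU, ← Matrix.mul_assoc, hF, Matrix.one_mul]
  have hFd : Fᴴ * (Ω * Ω * F) = rdiag 𝕜 d := by
    rw [← hRd, hFdef, Matrix.conjTranspose_mul]
    simp only [Matrix.mul_assoc]
  have hΩ2F : Ω * Ω * F = F * rdiag 𝕜 d := by
    rw [← hFd, ← Matrix.mul_assoc F, hFU, ← Matrix.mul_assoc (projMatrix U) (Ω * Ω) F,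
      ← sq_commute hΩ.tangent, Matrix.mul_assoc (Ω * Ω) (projMatrix U) F, hpF]
  have hΩF2 : (Ω * F)ᴴ * (Ω * F) = rdiag 𝕜 fun i => -d i := by
    rw [← rdiag_neg, ← hFd, Matrix.conjTranspose_mul, hΩ.skew]
    simp only [Matrix.mul_assoc, Matrix.mul_neg, Matrix.neg_mul]
  have hd0 := rdiag_nonneg_of_eq hΩF2
  set θ : Fin r → ℝ := fun i => √(-d i) with hθ
  have hθ0 : ∀ i, 0 ≤ θ i := fun i => Real.sqrt_nonneg _
  have hθ2 : ∀ i, θ i ^ 2 = -d i := fun i => Real.sq_sqrt (hd0 i)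
  obtain ⟨W, hWθ, hW, -⟩ := exists_mul_rdiag_eq (D := Ω * F) (σ := θ) (by
    rw [hΩF2]
    simp only [hθ2])
  have hΩW : Ω * W = -(F * rdiag 𝕜 θ) := by
    rw [hW, ← Matrix.mul_assoc, ← Matrix.mul_assoc, hΩ2F, Matrix.mul_assoc, rdiag_mul,
      ← Matrix.mul_neg, rdiag_neg]
    congr 2
    funext i
    have : d i = -(θ i ^ 2) := by rw [hθ2, neg_neg]
    rw [this]
    by_cases hi : θ i = 0
    · simp [hi]
    · field_simp
  have hFW : Fᴴ * W = 0 := by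
    have hz := proj_mul_mul_eq_zero (projMatrix_mul_self U) hΩ.tangent
    have e : Fᴴ * (Ω * F) = 0 := by
      calc Fᴴ * (Ω * F) = Fᴴ * projMatrix U * (Ω * (projMatrix U * F)) := by rw [hFp, hpF]
        _ = Fᴴ * (projMatrix U * Ω * projMatrix U) * F := by simp only [Matrix.mul_assoc]
        _ = 0 := by rw [hz, Matrix.mul_zero, Matrix.zero_mul]
    rw [hW, ← Matrix.mul_assoc, e, Matrix.zero_mul]
  set H := NormedSpace.exp Ω * F with hH
  have hs : (NormedSpace.exp Ω)ᴴ = NormedSpace.exp (-Ω) := by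
    simpa using conjTranspose_exp_smul hΩ.skew 1
  have hexp : (NormedSpace.exp Ω)ᴴ * NormedSpace.exp Ω = 1 := by
    simpa using exp_smul_unitary hΩ.skew 1
  have hFH : Fᴴ * H = rdiag 𝕜 fun i => Real.cos (θ i) := by
    rw [hH, exp_smul_mul_frame hWθ.symm hΩW, Matrix.mul_add, ← Matrix.mul_assoc, hF,
      ← Matrix.mul_assoc, hFW, Matrix.one_mul, Matrix.zero_mul, add_zero]
  have hH1 : Hᴴ * H = 1 := by
    rw [hH, Matrix.conjTranspose_mul, Matrix.mul_assoc, ← Matrix.mul_assoc (NormedSpace.exp Ω)ᴴ,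
      hexp, Matrix.one_mul, hF]
  have hHV : H * Hᴴ = projMatrix V := by
    have h2 := hγ 1 (by simp)
    simp only [one_smul] at h2
    rw [← h1, h2, ← hs, ← hFU, hH, Matrix.conjTranspose_mul]
    simp only [Matrix.mul_assoc]
  -- Sign changes make `H` a partner of `F` with nonnegative cosines, which computes the distance
  -- before the angles are known to be at most `π/2`.
  let ε : Fin r → ℝ := fun i => if 0 ≤ Real.cos (θ i) then 1 else -1
  have hε : rdiag 𝕜 ε * rdiag 𝕜 ε = 1 := by
    rw [rdiag_mul, ← rdiag_one]
    congr 1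
    funext i
    simp only [ε]
    split_ifs <;> simp
  have hpair : IsFramePair U V F (H * rdiag 𝕜 ε) fun i => |Real.cos (θ i)| := by
    refine ⟨hF, hFU, ?_, ?_, fun i => abs_nonneg _, ?_⟩
    · rw [Matrix.conjTranspose_mul, Matrix.mul_assoc, ← Matrix.mul_assoc Hᴴ, hH1, Matrix.one_mul,
        rdiag_conjTranspose, hε]
    · rw [Matrix.conjTranspose_mul, Matrix.mul_assoc, ← Matrix.mul_assoc (rdiag 𝕜 ε),
        rdiag_conjTranspose, hε, Matrix.one_mul, hHV]
    · rw [← Matrix.mul_assoc, hFH, rdiag_mul]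
      congr 1
      funext i
      simp only [ε]
      split_ifs with hi
      · rw [abs_of_nonneg hi, mul_one]
      · rw [abs_of_neg (not_le.1 hi), mul_neg_one]
  have hsum : ∑ i, Real.arccos |Real.cos (θ i)| ^ 2 = ∑ i, θ i ^ 2 := by
    have h3 : √(∑ i, θ i ^ 2) = √(∑ i, Real.arccos |Real.cos (θ i)| ^ 2) := by
      rw [← hpair.grDist_eq, ← hlen, hγ.grLength_eq hΩ hF hFU,
        ← Real.sqrt_sq (norm_nonneg (Ω * F)), norm_sq_eq_re_trace, hΩF2, re_trace_rdiag]
      simp only [hθ2]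
    exact ((Real.sqrt_inj (Finset.sum_nonneg fun i _ => sq_nonneg _)
      (Finset.sum_nonneg fun i _ => sq_nonneg _)).1 h3).symm
  -- Minimality equates two sums that are ordered term by term. Each angle thus equals its folded
  -- value, so it is at most `π/2` and the signs were unnecessary.
  have heq := (Finset.sum_eq_sum_iff_of_le fun i _ =>
    pow_le_pow_left₀ (Real.arccos_nonneg _) (arccos_abs_cos_le (hθ0 i)) 2).1 hsum
  have hθ' : ∀ i, θ i ≤ Real.pi / 2 := by
    intro i
    rw [← (pow_left_inj₀ (Real.arccos_nonneg _) (hθ0 i) two_ne_zero).1 (heq i (Finset.mem_univ i))]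
    exact Real.arccos_le_pi_div_two.2 (abs_nonneg _)
  refine ⟨Ω, F, H, fun i => Real.cos (θ i), hΩ, hγ, ⟨hF, hFU, hH1, hHV, fun i =>
    Real.cos_nonneg_of_neg_pi_div_two_le_of_le (by linarith [hθ0 i, Real.pi_pos]) (hθ' i), hFH⟩,
    fun i j hij => ?_, rfl⟩
  exact Real.cos_le_cos_of_nonneg_of_le_pi (hθ0 i) (by linarith [hθ' j, Real.pi_pos])
    (Real.sqrt_le_sqrt (neg_le_neg (hd hij)))

end Minimizing

/-! ### Parallel transport -/

section ParallelTransport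

variable {𝕜 : Type*} [RCLike 𝕜] {n r s : ℕ}

theorem conjBlock_fromCols (F : Matrix (Fin n) (Fin r) 𝕜) (K : Matrix (Fin n) (Fin (n - r)) 𝕜)
    (M : Matrix (Fin r) (Fin r) 𝕜) (X : Matrix (Fin r) (Fin (n - r)) 𝕜)
    (Y : Matrix (Fin (n - r)) (Fin r) 𝕜) (N : Matrix (Fin (n - r)) (Fin (n - r)) 𝕜) :
    conjBlock (Matrix.fromCols F K) M X Y N =
      (F * M + K * Y) * Fᴴ + (F * X + K * N) * Kᴴ := by
  rw [conjBlock, Matrix.fromCols_mul_fromBlocks, Matrix.conjTranspose_fromCols_eq_fromRows_conjTranspose,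
    Matrix.fromCols_mul_fromRows]

theorem exists_orthogonal_frame (U : Gr 𝕜 r n) : ∃ K : Matrix (Fin n) (Fin (n - r)) 𝕜,
    Kᴴ * K = 1 ∧ K * Kᴴ = 1 - projMatrix U := by
  have hr : Module.finrank 𝕜 (U.1ᗮ : Submodule 𝕜 (EuclideanSpace 𝕜 (Fin n))) = n - r := by
    have h1 := U.1.finrank_add_finrank_orthogonal
    rw [U.2, finrank_euclideanSpace_fin] at h1
    omega
  obtain ⟨K, hK, hKU⟩ := exists_frame (⟨U.1ᗮ, hr⟩ : Gr 𝕜 (n - r) n)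
  refine ⟨K, hK, ?_⟩
  rw [hKU]
  apply EquivLike.injective (Matrix.toEuclideanCLM (n := Fin n) (𝕜 := 𝕜))
  rw [map_sub, toEuclideanCLM_projMatrix, toEuclideanCLM_projMatrix, map_one,
    Submodule.starProjection_orthogonal']

/-- In a unitary basis adapted to `π(A)`, horizontal vectors are the Hermitian matrices with zero
diagonal blocks. As a condition on the projection alone this avoids the choice of `Q`, and it is the
tangency condition of the Grassmannian at `π(A)`. -/
theorem mem_horizontalSpace_iff (A : HermPSD 𝕜 n r) (Y : Matrix (Fin n) (Fin n) 𝕜) :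
    Y ∈ horizontalSpace A ↔
      Yᴴ = Y ∧ Y * projMatrix (proj A) + projMatrix (proj A) * Y = Y := by
  constructor
  · rintro ⟨Q, M, X, hQ, -, hA, hY⟩
    obtain ⟨F, K, rfl⟩ : ∃ F K, Q = Matrix.fromCols F K := ⟨_, _, (Matrix.fromCols_toCols Q).symm⟩
    rw [Matrix.conjTranspose_fromCols_eq_fromRows_conjTranspose, Matrix.fromRows_mul_fromCols,
      ← Matrix.fromBlocks_one, Matrix.fromBlocks_inj] at hQ
    obtain ⟨hF, -, hKF, -⟩ := hQ
    rw [conjBlock_fromCols] at hA hY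
    simp only [Matrix.mul_zero, add_zero, Matrix.zero_mul, zero_add] at hA hY
    -- `M` is not assumed invertible. The block form only puts `π(A)` inside the range of `F`;
    -- equality of traces, both `r`, does the rest.
    have hq : projMatrix (proj A) = F * Fᴴ := by
      have h1 := projMatrix_proj_mul_eq_zero A (N := 1 - F * Fᴴ) (by
        rw [hA, Matrix.mul_sub, Matrix.mul_one, Matrix.mul_assoc (F * M) Fᴴ,
          ← Matrix.mul_assoc Fᴴ, hF, Matrix.one_mul, sub_self])
      rw [Matrix.mul_sub, Matrix.mul_one, sub_eq_zero] at h1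
      have h2 := congrArg Matrix.conjTranspose h1
      rw [Matrix.conjTranspose_mul, projMatrix_isHermitian, Matrix.conjTranspose_mul,
        Matrix.conjTranspose_conjTranspose] at h2
      symm
      rw [← sub_eq_zero]
      apply eq_zero_of_isIdempotent
      · simp [projMatrix_isHermitian]
      · rw [Matrix.sub_mul, Matrix.mul_sub, Matrix.mul_sub, ← h1, ← h2, projMatrix_mul_self,
          Matrix.mul_assoc, ← Matrix.mul_assoc Fᴴ, hF, Matrix.one_mul]
        simp
      · rw [Matrix.trace_sub, trace_projMatrix, Matrix.trace_mul_comm, hF]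
        simp
    have hFK : Fᴴ * K = 0 := by simpa using congrArg Matrix.conjTranspose hKF
    refine ⟨?_, ?_⟩
    · rw [hY]
      simp only [Matrix.conjTranspose_add, Matrix.conjTranspose_mul,
        Matrix.conjTranspose_conjTranspose, Matrix.mul_assoc]
      abel
    · rw [hq, hY]
      simp only [Matrix.add_mul, Matrix.mul_add, Matrix.mul_assoc]
      simp only [← Matrix.mul_assoc Fᴴ, ← Matrix.mul_assoc Kᴴ, hF, hKF, hFK, Matrix.one_mul,
        Matrix.zero_mul, Matrix.mul_zero, add_zero, zero_add]
  · rintro ⟨hY, hYp⟩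
    obtain ⟨F, hF, hFU⟩ := exists_frame (proj A)
    obtain ⟨K, hK, hKU⟩ := exists_orthogonal_frame (proj A)
    have hpF : projMatrix (proj A) * F = F := by
      rw [← hFU, Matrix.mul_assoc, hF, Matrix.mul_one]
    have hKF : Kᴴ * F = 0 := by
      have h1 : Kᴴ * (K * Kᴴ) = Kᴴ := by rw [← Matrix.mul_assoc, hK, Matrix.one_mul]
      rw [← h1, hKU, Matrix.mul_assoc, Matrix.sub_mul, hpF]
      simp
    have hFK : Fᴴ * K = 0 := by simpa using congrArg Matrix.conjTranspose hKF
    have hz := proj_mul_mul_eq_zero (projMatrix_mul_self (proj A)) hYp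
    have hQ : (Matrix.fromCols F K)ᴴ * Matrix.fromCols F K = 1 := by
      rw [Matrix.conjTranspose_fromCols_eq_fromRows_conjTranspose, Matrix.fromRows_mul_fromCols, hF,
        hK, hKF, hFK, Matrix.fromBlocks_one]
    refine ⟨Matrix.fromCols F K, Fᴴ * A.1 * F, Fᴴ * Y * K, hQ, ?_, ?_, ?_⟩
    · rw [Matrix.conjTranspose_fromCols_eq_fromRows_conjTranspose, Matrix.fromCols_mul_fromRows,
        hFU, hKU]
      abel
    · rw [conjBlock_fromCols]
      simp only [Matrix.mul_zero, add_zero, Matrix.zero_mul]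
      calc A.1 = projMatrix (proj A) * A.1 * projMatrix (proj A) := by
            rw [projMatrix_proj_mul, mul_projMatrix_proj]
        _ = F * (Fᴴ * A.1 * F) * Fᴴ := by rw [← hFU]; simp only [Matrix.mul_assoc]
    · rw [conjBlock_fromCols]
      simp only [Matrix.mul_zero, add_zero, zero_add]
      have e1 : K * (Fᴴ * Y * K)ᴴ * Fᴴ = (K * Kᴴ) * Y * (F * Fᴴ) := by
        rw [Matrix.conjTranspose_mul, Matrix.conjTranspose_mul, hY,
          Matrix.conjTranspose_conjTranspose]
        simp only [Matrix.mul_assoc]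
      have e2 : F * (Fᴴ * Y * K) * Kᴴ = (F * Fᴴ) * Y * (K * Kᴴ) := by
        simp only [Matrix.mul_assoc]
      rw [e1, e2, hFU, hKU, Matrix.sub_mul, Matrix.sub_mul, hz, Matrix.mul_sub, hz, Matrix.one_mul,
        Matrix.mul_one, sub_zero, sub_zero, hYp]

/-- Conjugating `A` by `exp(tΩ)` moves `π(A)` along `γ`, and the velocity `[Ω, P]` of an
off-diagonal `Ω` with a block-diagonal `P` is off-diagonal. -/
theorem exists_parallelTransport {A : HermPSD 𝕜 n r} {Ω : Matrix (Fin n) (Fin n) 𝕜}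
    {γ : ℝ → Gr 𝕜 r n} (hΩ : IsGenerator (proj A) Ω) (hγ : IsOrbit (proj A) Ω γ) :
    ∃ P : ℝ → HermPSD 𝕜 n r, IsParallelTransport A γ P := by
  let P : ℝ → HermPSD 𝕜 n r := fun t =>
    unitaryConj A (NormedSpace.exp (t • Ω)) (exp_smul_unitary hΩ.skew t)
  have hP : (fun t => (P t).1) = fun t =>
      NormedSpace.exp (t • Ω) * A.1 * NormedSpace.exp (t • (-Ω)) := by
    funext t
    rw [← conjTranspose_exp_smul hΩ.skew]
    rfl
  refine ⟨P, ?_, ?_, fun t ht => ?_⟩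
  · rw [hP]
    exact ((contDiff_exp_smul Ω).contDiffOn.matrix_mul contDiffOn_const).matrix_mul
      (contDiff_exp_smul (-Ω)).contDiffOn
  · apply Subtype.ext
    simp [P, unitaryConj]
  · have hpr : proj (P t) = γ t := by
      apply projMatrix_injective
      rw [projMatrix_proj_unitaryConj, conjTranspose_exp_smul hΩ.skew, hγ t ht]
    refine ⟨hpr, ?_⟩
    have hd : HasDerivWithinAt (fun τ => (P τ).1) (Ω * (P t).1 - (P t).1 * Ω) (Icc 0 1) t := by
      have h1 := (hasDerivAt_conj_exp Ω A.1 t).hasDerivWithinAt (s := Icc 0 1)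
      rw [← congrFun hP t] at h1
      rw [hP]
      exact h1
    rw [velocity_eq ht hd, mem_horizontalSpace_iff]
    have hG := (hγ.isGenerator hΩ ht).tangent
    rw [← hpr] at hG
    have hz := proj_mul_mul_eq_zero (projMatrix_mul_self _) hG
    have h1 : (P t).1 * Ω * projMatrix (proj (P t)) = 0 := by
      rw [← mul_projMatrix_proj (P t), Matrix.mul_assoc (P t).1, Matrix.mul_assoc (P t).1, hz,
        Matrix.mul_zero]
    have h2 : projMatrix (proj (P t)) * (Ω * (P t).1) = 0 := by
      rw [← projMatrix_proj_mul (P t), ← Matrix.mul_assoc, ← Matrix.mul_assoc, hz, Matrix.zero_mul]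
    constructor
    · rw [Matrix.conjTranspose_sub, Matrix.conjTranspose_mul, Matrix.conjTranspose_mul, hΩ.skew,
        (P t).2.1.1]
      simp only [Matrix.mul_neg, Matrix.neg_mul]
      abel
    · rw [Matrix.sub_mul, Matrix.mul_sub, h1, h2, Matrix.mul_assoc, mul_projMatrix_proj,
        ← Matrix.mul_assoc, projMatrix_proj_mul]
      abel

/-- Differentiating `pP = P = Pp`, with `p` the moving projection, determines the off-diagonal part
of `P'` from `p' = [Ω, p]`; horizontality kills the diagonal part. What is left is `P' = ΩP - PΩ`,
which has conjugation by the exponential as its only solution. -/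
theorem IsParallelTransport.eq_conj_exp {A : HermPSD 𝕜 n r} {Ω : Matrix (Fin n) (Fin n) 𝕜}
    {γ : ℝ → Gr 𝕜 r n} {P : ℝ → HermPSD 𝕜 n r} (h : IsParallelTransport A γ P)
    (hΩ : IsGenerator (proj A) Ω) (hγ : IsOrbit (proj A) Ω γ) :
    ∀ t ∈ Icc (0 : ℝ) 1,
      (P t).1 = NormedSpace.exp (t • Ω) * A.1 * NormedSpace.exp (t • (-Ω)) := by
  obtain ⟨hC, h0, hP⟩ := h
  have hd : ∀ t ∈ Icc (0 : ℝ) 1, HasDerivWithinAt (fun τ => (P τ).1)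
      (Ω * (P t).1 - (P t).1 * Ω) (Icc 0 1) t := by
    intro t ht
    have hY : HasDerivWithinAt (fun τ => (P τ).1) (velocity (fun τ => (P τ).1) t) (Icc 0 1) t :=
      (hC.differentiableOn (by simp) t ht).hasDerivWithinAt
    have hH := ((mem_horizontalSpace_iff _ _).1 (hP t ht).2).2
    set Y := velocity (fun τ => (P τ).1) t with hYdef
    have hp := hγ.hasDerivWithinAt ht
    have hG := (hγ.isGenerator hΩ ht).tangent
    have hz := proj_mul_mul_eq_zero (projMatrix_mul_self _) hG
    have hl : ∀ τ ∈ Icc (0 : ℝ) 1, projMatrix (γ τ) * (P τ).1 = (P τ).1 := fun τ hτ => by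
      rw [← (hP τ hτ).1, projMatrix_proj_mul]
    have hr : ∀ τ ∈ Icc (0 : ℝ) 1, (P τ).1 * projMatrix (γ τ) = (P τ).1 := fun τ hτ => by
      rw [← (hP τ hτ).1, mul_projMatrix_proj]
    rw [(hP t ht).1] at hH
    have e1 := hasDerivWithinAt_unique ht hY
      ((hp.matrix_mul hY).congr (fun τ hτ => (hl τ hτ).symm) (hl t ht).symm)
    have e2 := hasDerivWithinAt_unique ht hY
      ((hY.matrix_mul hp).congr (fun τ hτ => (hr τ hτ).symm) (hr t ht).symm)
    have e3 : projMatrix (γ t) * Ω * (P t).1 = 0 := by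
      rw [← hl t ht, ← Matrix.mul_assoc, hz, Matrix.zero_mul]
    have e4 : (P t).1 * (Ω * projMatrix (γ t)) = 0 := by
      rw [← hr t ht, Matrix.mul_assoc, ← Matrix.mul_assoc (projMatrix (γ t)), hz, Matrix.mul_zero]
    rw [Matrix.sub_mul, Matrix.mul_assoc Ω, hl t ht, e3, sub_zero] at e1
    rw [Matrix.mul_sub, ← Matrix.mul_assoc _ _ Ω, hr t ht, e4, zero_sub] at e2
    have e5 : projMatrix (γ t) * Y = Y - Ω * (P t).1 := eq_sub_of_add_eq' e1.symm
    have e6 : Y * projMatrix (γ t) = Y + (P t).1 * Ω := by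
      rw [← sub_eq_add_neg] at e2
      exact sub_eq_iff_eq_add.1 e2.symm
    refine hY.congr_deriv ?_
    rw [e5, e6] at hH
    have e7 : Y + (Y - (Ω * (P t).1 - (P t).1 * Ω)) = Y := by
      rw [← sub_eq_zero, ← sub_eq_zero.2 hH]
      abel
    exact sub_eq_zero.1 (add_eq_left.1 e7)
  intro t ht
  have := eq_exp_smul_mul_mul hd t ht
  rwa [h0] at this

theorem IsMinGeodesic.exists_unique_parallelTransport {A B : HermPSD 𝕜 n r} {γ : ℝ → Gr 𝕜 r n}
    (h : IsMinGeodesic (proj A) (proj B) γ) :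
    ∃ P : ℝ → HermPSD 𝕜 n r, IsParallelTransport A γ P ∧
      ∀ P' : ℝ → HermPSD 𝕜 n r, IsParallelTransport A γ P' → EqOn P' P (Icc 0 1) := by
  obtain ⟨Ω, -, -, -, hΩ, hγ, -⟩ := h.exists_isFramePair
  obtain ⟨P, hP⟩ := exists_parallelTransport hΩ hγ
  refine ⟨P, hP, fun P' hP' t ht => Subtype.ext ?_⟩
  rw [hP'.eq_conj_exp hΩ hγ t ht, hP.eq_conj_exp hΩ hγ t ht]

end ParallelTransport

/-! ### Unitary invariance of the distance on positive definite matrices -/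

section UnitaryInvariance

variable {𝕜 : Type*} [RCLike 𝕜] {n r : ℕ}

/-- The conjugate `R* M R` of `M` by a unitary matrix `R`. -/
def conjPD (M : HermPD 𝕜 r) (R : Matrix (Fin r) (Fin r) 𝕜) (hR : Rᴴ * R = 1) : HermPD 𝕜 r :=
  ⟨Rᴴ * M.1 * R, M.2.conjTranspose_mul_mul_same (B := R) fun x y hxy => by
    have := congrArg (Rᴴ *ᵥ ·) hxy
    simpa [Matrix.mulVec_mulVec, hR] using this⟩

theorem pdLength_conjPD (c : ℝ → HermPD 𝕜 r) (hc : ContDiffOn ℝ 1 (fun t => (c t).1) (Icc 0 1))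
    (R : Matrix (Fin r) (Fin r) 𝕜) (hR : Rᴴ * R = 1) :
    pdLength (fun t => conjPD (c t) R hR) = pdLength c := by
  have hR' : R * Rᴴ = 1 := mul_eq_one_comm.1 hR
  refine intervalIntegral.integral_congr fun t ht => ?_
  rw [uIcc_of_le zero_le_one] at ht
  have hd := (hc.differentiableOn one_ne_zero t ht).hasDerivWithinAt
  have hv : velocity (fun τ => (conjPD (c τ) R hR).1) t = Rᴴ * velocity (fun τ => (c τ).1) t * R :=
    velocity_eq ht ((hd.matrix_const_mul Rᴴ).matrix_mul_const R)
  have hu : IsUnit (c t).1.det := (Matrix.isUnit_iff_isUnit_det _).1 (c t).2.isUnit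
  have hi : (conjPD (c t) R hR).1⁻¹ = Rᴴ * (c t).1⁻¹ * R := by
    apply Matrix.inv_eq_right_inv
    calc Rᴴ * (c t).1 * R * (Rᴴ * (c t).1⁻¹ * R)
        = Rᴴ * ((c t).1 * (R * Rᴴ) * (c t).1⁻¹) * R := by simp only [Matrix.mul_assoc]
      _ = 1 := by rw [hR', Matrix.mul_one, Matrix.mul_nonsing_inv _ hu, Matrix.mul_one, hR]
  simp only [hv, hi]
  set X := velocity (fun τ => (c τ).1) t
  set Z := (c t).1⁻¹
  have e : Rᴴ * Z * R * (Rᴴ * X * R) * (Rᴴ * Z * R) * (Rᴴ * X * R) =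
      Rᴴ * (Z * (R * Rᴴ) * X * (R * Rᴴ) * Z * (R * Rᴴ) * X * R) := by
    simp only [Matrix.mul_assoc]
  rw [e, hR', Matrix.trace_mul_comm]
  simp only [Matrix.mul_one]
  rw [Matrix.mul_assoc _ R, hR', Matrix.mul_one]

/-- Conjugation by `R` preserves lengths of curves, and conjugation by `R*` inverts it; so both sets
of lengths contain each other. -/
theorem pdDist_conjPD (C D : HermPD 𝕜 r) (R : Matrix (Fin r) (Fin r) 𝕜) (hR : Rᴴ * R = 1) :
    pdDist (conjPD C R hR) (conjPD D R hR) = pdDist C D := by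
  have hsub : ∀ (C D : HermPD 𝕜 r) (R : Matrix (Fin r) (Fin r) 𝕜) (hR : Rᴴ * R = 1),
      {ℓ | ∃ c : ℝ → HermPD 𝕜 r, ContDiffOn ℝ 1 (fun t => (c t).1) (Icc 0 1) ∧
        c 0 = C ∧ c 1 = D ∧ ℓ = pdLength c} ⊆
      {ℓ | ∃ c : ℝ → HermPD 𝕜 r, ContDiffOn ℝ 1 (fun t => (c t).1) (Icc 0 1) ∧
        c 0 = conjPD C R hR ∧ c 1 = conjPD D R hR ∧ ℓ = pdLength c} := by
    rintro C D R hR ℓ ⟨c, hc, rfl, rfl, rfl⟩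
    exact ⟨fun t => conjPD (c t) R hR,
      (contDiffOn_const.matrix_mul hc).matrix_mul contDiffOn_const, rfl, rfl,
      (pdLength_conjPD c hc R hR).symm⟩
  have hR' : Rᴴᴴ * Rᴴ = 1 := by simpa using mul_eq_one_comm.1 hR
  have hinv : ∀ C : HermPD 𝕜 r, conjPD (conjPD C R hR) Rᴴ hR' = C := by
    intro C
    apply Subtype.ext
    have h1 : R * Rᴴ = 1 := mul_eq_one_comm.1 hR
    calc Rᴴᴴ * (Rᴴ * C.1 * R) * Rᴴ = (R * Rᴴ) * C.1 * (R * Rᴴ) := by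
          rw [Matrix.conjTranspose_conjTranspose]; simp only [Matrix.mul_assoc]
      _ = C.1 := by rw [h1, Matrix.one_mul, Matrix.mul_one]
  have h2 := hsub (conjPD C R hR) (conjPD D R hR) Rᴴ hR'
  rw [hinv, hinv] at h2
  exact congrArg sInf (h2.antisymm (hsub C D R hR))

theorem basisFrame_transition {U : Gr 𝕜 r n} (w v : OrthonormalBasis (Fin r) 𝕜 U.1) :
    basisFrame w * ((basisFrame w)ᴴ * basisFrame v) = basisFrame v := by
  rw [← Matrix.mul_assoc, basisFrame_mul_conjTranspose, ← basisFrame_mul_conjTranspose v,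
    Matrix.mul_assoc, basisFrame_conjTranspose_mul, Matrix.mul_one]

theorem transition_unitary {U : Gr 𝕜 r n} (w v : OrthonormalBasis (Fin r) 𝕜 U.1) :
    ((basisFrame w)ᴴ * basisFrame v)ᴴ * ((basisFrame w)ᴴ * basisFrame v) = 1 := by
  rw [Matrix.conjTranspose_mul, Matrix.conjTranspose_conjTranspose, Matrix.mul_assoc,
    basisFrame_transition, basisFrame_conjTranspose_mul]

theorem matrixRep_val {U : Gr 𝕜 r n} (C : Fiber U) (w : OrthonormalBasis (Fin r) 𝕜 U.1) :
    (matrixRep C w).1 = (basisFrame w)ᴴ * C.1.1 * basisFrame w :=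
  gramMatrix_eq _ _

theorem matrixRep_eq_conjPD {U : Gr 𝕜 r n} (C : Fiber U) (w v : OrthonormalBasis (Fin r) 𝕜 U.1)
    {R : Matrix (Fin r) (Fin r) 𝕜} (hR : Rᴴ * R = 1) (h : (basisFrame w)ᴴ * basisFrame v = R) :
    matrixRep C v = conjPD (matrixRep C w) R hR := by
  apply Subtype.ext
  have h1 : basisFrame w * R = basisFrame v := by rw [← h, basisFrame_transition]
  change _ = Rᴴ * (matrixRep C w).1 * R
  rw [matrixRep_val, matrixRep_val, ← h1, Matrix.conjTranspose_mul]
  simp only [Matrix.mul_assoc]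

theorem pdDist_matrixRep {U : Gr 𝕜 r n} (C D : Fiber U) (w v : OrthonormalBasis (Fin r) 𝕜 U.1) :
    pdDist (matrixRep C v) (matrixRep D v) = pdDist (matrixRep C w) (matrixRep D w) := by
  rw [matrixRep_eq_conjPD C w v (transition_unitary w v) rfl,
    matrixRep_eq_conjPD D w v (transition_unitary w v) rfl, pdDist_conjPD]

end UnitaryInvariance

/-! ### The geometric distance -/

section GeometricDistance

variable {𝕜 : Type*} [RCLike 𝕜] {n r : ℕ}

theorem isPrincipal_iff {U V : Gr 𝕜 r n} (u : OrthonormalBasis (Fin r) 𝕜 U.1)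
    (v : OrthonormalBasis (Fin r) 𝕜 V.1) :
    IsPrincipal u v ↔ ∃ σ : Fin r → ℝ, Antitone σ ∧
      IsFramePair U V (basisFrame u) (basisFrame v) σ := by
  constructor
  · rintro ⟨σ, hσ, hσ0, h⟩
    refine ⟨fun i => σ i, fun i j hij => hσ hij, basisFrame_conjTranspose_mul u,
      basisFrame_mul_conjTranspose u, basisFrame_conjTranspose_mul v,
      basisFrame_mul_conjTranspose v, fun i => hσ0 i, ?_⟩
    ext i j
    rw [← inner_eq_frame, h i j]
    exact (if_congr Fin.ext_iff.symm rfl rfl).trans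
      (Matrix.diagonal_apply (fun i : Fin r => ((σ i : ℝ) : 𝕜)) i j).symm
  · rintro ⟨σ, hσ, h⟩
    -- Extension by zero stays antitone because the entries are nonnegative.
    refine ⟨fun k => if hk : k < r then σ ⟨k, hk⟩ else 0, fun k l hkl => ?_, fun k => ?_,
      fun i j => ?_⟩
    · by_cases hl : l < r
      · simp only [hl, lt_of_le_of_lt hkl hl, dif_pos]
        exact hσ hkl
      · simp only [hl, dif_neg, not_false_eq_true]
        split_ifs
        · exact h.nonneg _
        · exact le_rfl
    · simp only
      split_ifs
      · exact h.nonneg _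
      · exact le_rfl
    · refine ((inner_eq_frame (fun i => (u i : EuclideanSpace 𝕜 (Fin n))) (fun j =>
        (v j : EuclideanSpace 𝕜 (Fin n))) i j).trans (congrFun (congrFun h.diag i) j)).trans
        ((Matrix.diagonal_apply _ i j).trans (if_congr Fin.ext_iff ?_ rfl))
      simp

theorem IsFramePair.symm {U V : Gr 𝕜 r n} {F H : Matrix (Fin n) (Fin r) 𝕜} {σ : Fin r → ℝ}
    (h : IsFramePair U V F H σ) : IsFramePair V U H F σ :=
  ⟨h.right_isometry, h.right_range, h.left_isometry, h.left_range, h.nonneg, h.diag'⟩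

theorem IsPrincipal.symm {U V : Gr 𝕜 r n} {u : OrthonormalBasis (Fin r) 𝕜 U.1}
    {v : OrthonormalBasis (Fin r) 𝕜 V.1} (h : IsPrincipal u v) : IsPrincipal v u := by
  rw [isPrincipal_iff] at *
  obtain ⟨σ, hσ, h⟩ := h
  exact ⟨σ, hσ, h.symm⟩

/-- Commuting with `σ²` forces `R i j = 0` unless `σ i ^ 2 = σ j ^ 2`, which for nonnegative entries
means `σ i = σ j`. -/
theorem commute_rdiag_of_sq {R : Matrix (Fin r) (Fin r) 𝕜} {σ : Fin r → ℝ} (hσ : ∀ i, 0 ≤ σ i)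
    (h : R * (rdiag 𝕜 fun i => σ i ^ 2) = (rdiag 𝕜 fun i => σ i ^ 2) * R) :
    R * rdiag 𝕜 σ = rdiag 𝕜 σ * R := by
  ext i j
  have h1 := congrFun (congrFun h i) j
  rw [Matrix.mul_diagonal, Matrix.diagonal_mul, mul_comm, ← sub_eq_zero, ← sub_mul,
    mul_eq_zero, sub_eq_zero] at h1
  rw [Matrix.mul_diagonal, Matrix.diagonal_mul]
  rcases h1 with h1 | h1
  · have h2 : σ j = σ i := by
      rw [← pow_left_inj₀ (hσ j) (hσ i) two_ne_zero]
      exact_mod_cast h1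
    rw [h2, mul_comm]
  · simp [h1]

/-- Any pair of principal vectors can be rotated so that its first member agrees with the first
member of a given pair. -/
theorem IsPrincipal.exists_rotate {U V : Gr 𝕜 r n} {u u' : OrthonormalBasis (Fin r) 𝕜 U.1}
    {v v' : OrthonormalBasis (Fin r) 𝕜 V.1} (h : IsPrincipal u v) (h' : IsPrincipal u' v') :
    ∃ v'' : OrthonormalBasis (Fin r) 𝕜 V.1, IsPrincipal u v'' ∧
      ∃ (T : Matrix (Fin r) (Fin r) 𝕜) (hT : Tᴴ * T = 1),
        (∀ A : Fiber U, matrixRep A u = conjPD (matrixRep A u') T hT) ∧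
        (∀ B : Fiber V, matrixRep B v'' = conjPD (matrixRep B v') T hT) := by
  obtain ⟨σ, hσ, hp⟩ := (isPrincipal_iff u v).1 h
  obtain ⟨σ', hσ', hp'⟩ := (isPrincipal_iff u' v').1 h'
  have hTT := transition_unitary u' u
  have hFT := basisFrame_transition u' u
  set F := basisFrame u with hF
  set H := basisFrame v with hH
  set F' := basisFrame u' with hF'
  set H' := basisFrame v' with hH'
  set T := F'ᴴ * F with hT
  clear_value T F H F' H'
  have hTT' : T * Tᴴ = 1 := mul_eq_one_comm.1 hTT
  have hsq : ∀ {X Y : Matrix (Fin n) (Fin r) 𝕜} {τ : Fin r → ℝ}, IsFramePair U V X Y τ →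
      Xᴴ * projMatrix V * X = rdiag 𝕜 fun i => τ i ^ 2 := by
    intro X Y τ hXY
    calc Xᴴ * projMatrix V * X = (Xᴴ * Y) * (Yᴴ * X) := by
          rw [← hXY.right_range]; simp only [Matrix.mul_assoc]
      _ = _ := by rw [hXY.diag, hXY.diag', rdiag_mul]; simp only [pow_two]
  -- Both `σ²` and `σ'²` represent the compression to `U` of the projection onto `V`, so `T`
  -- conjugates one into the other. The orderings give `σ = σ'`, then `T` commutes with `σ`, and `H'
  -- T` is again a partner of `F = F' T`.
  have hconj : Tᴴ * (rdiag 𝕜 fun i => σ' i ^ 2) * T = rdiag 𝕜 fun i => σ i ^ 2 := by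
    rw [← hsq hp, ← hsq hp', ← hFT, Matrix.conjTranspose_mul]
    simp only [Matrix.mul_assoc]
  have hσσ : σ' = σ := by
    have h1 := eq_of_unitary_conj_rdiag
      (fun i j hij => pow_le_pow_left₀ (hp'.nonneg j) (hσ' hij) 2)
      (fun i j hij => pow_le_pow_left₀ (hp.nonneg j) (hσ hij) 2) hTT hconj
    funext i
    exact (pow_left_inj₀ (hp'.nonneg i) (hp.nonneg i) two_ne_zero).1 (congrFun h1 i)
  subst hσσ
  have hcomm : T * rdiag 𝕜 σ' = rdiag 𝕜 σ' * T := by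
    apply commute_rdiag_of_sq hp.nonneg
    nth_rewrite 1 [← hconj]
    rw [← Matrix.mul_assoc, ← Matrix.mul_assoc, hTT', Matrix.one_mul]
  have hH'T : (H' * T)ᴴ * (H' * T) = 1 := by
    rw [Matrix.conjTranspose_mul, Matrix.mul_assoc, ← Matrix.mul_assoc H'ᴴ, hp'.right_isometry,
      Matrix.one_mul, hTT]
  have hH'T' : H' * T * (H' * T)ᴴ = projMatrix V := by
    rw [Matrix.conjTranspose_mul, Matrix.mul_assoc, ← Matrix.mul_assoc T, hTT', Matrix.one_mul,
      hp'.right_range]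
  obtain ⟨v'', hv''⟩ := exists_basis_frame_eq (U := V) (H' * T) hH'T hH'T'
  refine ⟨v'', (isPrincipal_iff u v'').2 ⟨σ', hσ', ?_⟩, T, hTT,
    fun A => matrixRep_eq_conjPD A u' u hTT (by rw [hT, hF, hF']), fun B => matrixRep_eq_conjPD B v' v'' hTT ?_⟩
  · rw [hv'', ← hF]
    refine ⟨hp.left_isometry, hp.left_range, hH'T, hH'T', hp.nonneg, ?_⟩
    rw [← hFT, Matrix.conjTranspose_mul, Matrix.mul_assoc, ← Matrix.mul_assoc F'ᴴ, hp'.diag,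
      ← hcomm, ← Matrix.mul_assoc, hTT, Matrix.one_mul]
  · rw [hv'', ← hH', ← Matrix.mul_assoc, hp'.right_isometry, Matrix.one_mul]

/-- If every slice produces the same set of values, both suprema range over a singleton. -/
theorem hausdorffFn_eq_of_image_eq {α β : Type*} (f : α → β → ℝ) (Z : Set (α × β)) (S : Set ℝ)
    (hZ : Z.Nonempty) (h1 : ∀ p ∈ Z, (fun y => f p.1 y) '' {y | (p.1, y) ∈ Z} = S)
    (h2 : ∀ p ∈ Z, (fun x => f x p.2) '' {x | (x, p.2) ∈ Z} = S) :
    hausdorffFn f Z = sInf S := by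
  have e1 : (fun x => pointSetDist f x {y | (x, y) ∈ Z}) '' (Prod.fst '' Z) = {sInf S} := by
    rw [image_image]
    refine (image_congr fun p hp => ?_).trans (hZ.image_const _)
    simp only [pointSetDist]
    rw [h1 p hp]
  have e2 : (fun y => setPointDist f {x | (x, y) ∈ Z} y) '' (Prod.snd '' Z) = {sInf S} := by
    rw [image_image]
    refine (image_congr fun p hp => ?_).trans (hZ.image_const _)
    simp only [setPointDist]
    rw [h2 p hp]
  rw [hausdorffFn, e1, e2, csSup_singleton, max_self]

theorem exists_isPrincipal (U V : Gr 𝕜 r n) : ∃ (u : OrthonormalBasis (Fin r) 𝕜 U.1)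
    (v : OrthonormalBasis (Fin r) 𝕜 V.1), IsPrincipal u v := by
  obtain ⟨F, H, σ, h, hσ⟩ := exists_isFramePair U V
  obtain ⟨u, rfl⟩ := exists_basis_frame_eq F h.left_isometry h.left_range
  obtain ⟨v, rfl⟩ := exists_basis_frame_eq H h.right_isometry h.right_range
  exact ⟨u, v, (isPrincipal_iff u v).2 ⟨σ, hσ, h⟩⟩

theorem hausdorffFn_repSet {U V : Gr 𝕜 r n} (X : Fiber U) (Y : Fiber V) :
    hausdorffFn pdDist (repSet X Y) = sInf ((fun p => pdDist p.1 p.2) '' repSet X Y) := by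
  obtain ⟨u₀, v₀, h₀⟩ := exists_isPrincipal U V
  refine hausdorffFn_eq_of_image_eq _ _ _ ⟨_, u₀, v₀, h₀, rfl⟩ ?_ ?_
  · rintro p ⟨u, v, h, rfl⟩
    refine Subset.antisymm ?_ ?_
    · rintro _ ⟨y, hy, rfl⟩
      exact ⟨_, hy, rfl⟩
    · rintro _ ⟨p, ⟨u', v', h', rfl⟩, rfl⟩
      obtain ⟨v'', h'', T, hT, hA, hB⟩ := h.exists_rotate h'
      -- The value at `(u', v')` reappears in the slice of `u`: both matrices were conjugated by the
      -- same `T`.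
      refine ⟨matrixRep Y v'', ⟨u, v'', h'', rfl⟩, ?_⟩
      simp only
      rw [hA X, hB Y, pdDist_conjPD]
  · rintro p ⟨u, v, h, rfl⟩
    refine Subset.antisymm ?_ ?_
    · rintro _ ⟨x, hx, rfl⟩
      exact ⟨_, hx, rfl⟩
    · rintro _ ⟨p, ⟨u', v', h', rfl⟩, rfl⟩
      obtain ⟨u'', h'', T, hT, hB, hA⟩ := h.symm.exists_rotate h'.symm
      refine ⟨matrixRep X u'', ⟨u'', v, h''.symm, rfl⟩, ?_⟩
      simp only
      rw [hA X, hB Y, pdDist_conjPD]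

/-! ### Transports along minimizing geodesics read in principal vectors -/

theorem exists_isMinGeodesic (U V : Gr 𝕜 r n) : ∃ γ : ℝ → Gr 𝕜 r n, IsMinGeodesic U V γ := by
  obtain ⟨F, H, σ, h, -⟩ := exists_isFramePair U V
  obtain ⟨Ω, hΩ, hΩF, hn⟩ := h.exists_generator
  obtain ⟨γ, hγ⟩ := exists_orbit (U := U) hΩ.skew
  exact ⟨γ, h.isMinGeodesic hΩ hΩF hn hγ⟩

/-- `exp Ω` transports `A` by conjugation and maps `u` to `v`, so it cancels in the matrix
coefficients. -/
theorem IsParallelTransport.matrixRep_eq {A : HermPSD 𝕜 n r} {V : Gr 𝕜 r n} (C : Fiber V)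
    {Ω : Matrix (Fin n) (Fin n) 𝕜} {γ : ℝ → Gr 𝕜 r n} {P : ℝ → HermPSD 𝕜 n r}
    (h : IsParallelTransport A γ P) (hC : P 1 = C.1) (hΩ : IsGenerator (proj A) Ω)
    (hγ : IsOrbit (proj A) Ω γ) (u : OrthonormalBasis (Fin r) 𝕜 (proj A).1)
    (v : OrthonormalBasis (Fin r) 𝕜 V.1) (huv : NormedSpace.exp Ω * basisFrame u = basisFrame v) :
    matrixRep C v = matrixRep (⟨A, rfl⟩ : Fiber (proj A)) u := by
  apply Subtype.ext
  have h1 := h.eq_conj_exp hΩ hγ 1 (by simp)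
  simp only [one_smul] at h1
  have h2 : NormedSpace.exp (-Ω) * NormedSpace.exp Ω = 1 := by
    simpa using exp_neg_smul_mul Ω 1
  have h3 : (NormedSpace.exp Ω)ᴴ = NormedSpace.exp (-Ω) := by
    simpa using conjTranspose_exp_smul hΩ.skew 1
  rw [matrixRep_val, matrixRep_val, ← hC, h1, ← huv, Matrix.conjTranspose_mul, h3]
  calc (basisFrame u)ᴴ * NormedSpace.exp (-Ω) *
        (NormedSpace.exp Ω * A.1 * NormedSpace.exp (-Ω)) * (NormedSpace.exp Ω * basisFrame u)
      = (basisFrame u)ᴴ * (NormedSpace.exp (-Ω) * NormedSpace.exp Ω) * A.1 *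
        ((NormedSpace.exp (-Ω) * NormedSpace.exp Ω) * basisFrame u) := by
        simp only [Matrix.mul_assoc]
    _ = (basisFrame u)ᴴ * A.1 * basisFrame u := by rw [h2, Matrix.mul_one, Matrix.one_mul]

/-- Each minimizing geodesic gives a principal pair and each principal pair such a geodesic. The
equality concerns distances only: transports are read in the fixed basis `w`, while the pairs use a
varying `v`, and `pdDist_matrixRep` removes the difference. -/
theorem image_transportSet (A B : HermPSD 𝕜 n r) (w : OrthonormalBasis (Fin r) 𝕜 (proj B).1) :
    (fun x => pdDist x (matrixRep (⟨B, rfl⟩ : Fiber (proj B)) w)) ''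
        ((fun C => matrixRep C w) '' transportSet A B) =
      (fun p => pdDist p.1 p.2) ''
        repSet (⟨A, rfl⟩ : Fiber (proj A)) (⟨B, rfl⟩ : Fiber (proj B)) := by
  refine Subset.antisymm ?_ ?_
  · rintro _ ⟨_, ⟨C, ⟨γ, P, hγ, hP, hC⟩, rfl⟩, rfl⟩
    obtain ⟨Ω, F, H, σ, hΩ, ho, hp, hσ, hFH⟩ := hγ.exists_isFramePair
    obtain ⟨u, rfl⟩ := exists_basis_frame_eq F hp.left_isometry hp.left_range
    obtain ⟨v, rfl⟩ := exists_basis_frame_eq H hp.right_isometry hp.right_range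
    refine ⟨_, ⟨u, v, (isPrincipal_iff u v).2 ⟨σ, hσ, hp⟩, rfl⟩, ?_⟩
    simp only
    rw [← hP.matrixRep_eq C hC hΩ ho u v hFH, pdDist_matrixRep C _ w v]
  · rintro _ ⟨_, ⟨u, v, h, rfl⟩, rfl⟩
    obtain ⟨σ, hσ, hp⟩ := (isPrincipal_iff u v).1 h
    obtain ⟨Ω, hΩ, hΩF, hn⟩ := hp.exists_generator
    obtain ⟨γ, hγ⟩ := exists_orbit (U := proj A) hΩ.skew
    obtain ⟨P, hP⟩ := exists_parallelTransport hΩ hγ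
    have hP1 : proj (P 1) = proj B :=
      (hP.2.2 1 (by simp)).1.trans (hp.isOrbit_apply_one hΩ hΩF hγ)
    refine ⟨_, ⟨⟨P 1, hP1⟩, ⟨γ, P, hp.isMinGeodesic hΩ hΩF hn hγ, hP, rfl⟩, rfl⟩, ?_⟩
    simp only
    rw [← hP.matrixRep_eq ⟨P 1, hP1⟩ rfl hΩ hγ u v hΩF, pdDist_matrixRep _ _ w v]

theorem GD_sq (A B : HermPSD 𝕜 n r) (w : OrthonormalBasis (Fin r) 𝕜 (proj B).1) :
    GD grDist pdDist A B ^ 2 = grDist (proj A) (proj B) ^ 2 +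
      setPointDist pdDist ((fun C => matrixRep C w) '' transportSet A B)
        (matrixRep ⟨B, rfl⟩ w) ^ 2 := by
  rw [GD, Real.sq_sqrt (by positivity), hausdorffFn_repSet, setPointDist, image_transportSet]

end GeometricDistance

end PSDBundle

theorem mainTheorem3 {𝕜 : Type*} [RCLike 𝕜] {n r : ℕ} (A B : PSDBundle.HermPSD 𝕜 n r) :
    -- the parallel transports along minimizing geodesics are well defined
    (∃ γ : ℝ → PSDBundle.Gr 𝕜 r n,
      PSDBundle.IsMinGeodesic (PSDBundle.proj A) (PSDBundle.proj B) γ) ∧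
    (∀ γ : ℝ → PSDBundle.Gr 𝕜 r n,
      PSDBundle.IsMinGeodesic (PSDBundle.proj A) (PSDBundle.proj B) γ →
        ∃ P : ℝ → PSDBundle.HermPSD 𝕜 n r, PSDBundle.IsParallelTransport A γ P ∧
          ∀ P' : ℝ → PSDBundle.HermPSD 𝕜 n r, PSDBundle.IsParallelTransport A γ P' →
            Set.EqOn P' P (Set.Icc 0 1)) ∧
    -- the formula, for any orthonormal basis `w` of `π(B)`
    ∀ w : OrthonormalBasis (Fin r) 𝕜 (PSDBundle.proj B).1,
      PSDBundle.GD PSDBundle.grDist PSDBundle.pdDist A B ^ 2 =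
        PSDBundle.grDist (PSDBundle.proj A) (PSDBundle.proj B) ^ 2 +
        PSDBundle.setPointDist PSDBundle.pdDist
          ((fun C => PSDBundle.matrixRep C w) '' PSDBundle.transportSet A B)
          (PSDBundle.matrixRep ⟨B, rfl⟩ w) ^ 2 :=
  ⟨PSDBundle.exists_isMinGeodesic _ _, fun _ h => h.exists_unique_parallelTransport,
    PSDBundle.GD_sq A B⟩
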